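/- Let $d\in\mathbb N$, let $\Delta$ be a random variable in $\mathbb R^d$, and let $(\Delta_i)_{i\ge 1}$ be independent copies of $\Delta$. Let $(U_n)_{n\ge 2}$ be independent random variables, independent of $(\Delta_i)_{i\ge1}$, with $U_n$ uniform in $\{1,\dots,n-1\}$. Define the single-ball-addition random-walk Pólya urn by $X_1=\Delta_1$ and $X_n=X_{U_n}+\Delta_n$ for $n\ge 2$, and let $\mu_n=\sum_{i=1}^n\delta_{X_i}$. For $a>0$ and a finite Borel measure $\mu$ on $\mathbb R^d$, let $\Theta_a(\mu)$ be the Borel measure such that $\Theta_a(\mu)(B/a)=\mu(B)$ for every Borel set $B\subset\mathbb R^d$ (the image of $\mu$ under $x\mapsto x/a$). Assume that there are $\alpha>0$ and a random variable $\Lambda$ in $\mathbb R^d$ with law $\mathcal L(\Lambda)$ such that, as $n\to\infty$, \[ \frac1{n^{\alpha}}\sum_{i=1}^n\Delta_i\longrightarrow\Lambda\quad\text{in distribution.} \] Then, almost surely, as $n\to\infty$, \[ \Theta_{(\log n)^{\alpha}}(\mu_n/n)\longrightarrow\mathcal L(\Lambda)\quad\text{weakly.} \] -/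

import Mathlib

open MeasureTheory ProbabilityTheory Filter Topology

/-- The colours of the balls of the urn, as a function of the displacements `δ` and of the
choices `u`, with balls indexed from `0`: ball `0` has colour `δ 0`; ball `n + 1` has the colour
of ball `u n`, one of the earlier balls `0, …, n`, shifted by `δ (n + 1)`. -/
def urnColour {E : Type*} [Add E] (δ : ℕ → E) (u : (n : ℕ) → Fin (n + 1)) : ℕ → E
  | 0 => δ 0
  | n + 1 => urnColour δ u (u n) + δ (n + 1)
termination_by n => n
decreasing_by exact (u n).isLt

/-- The composition of the urn with `n` balls of colours `x 0, …, x (n - 1)`: the counting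
measure `∑ i < n, δ_{x i}`. -/
noncomputable def urnMeasure {E : Type*} [MeasurableSpace E] (x : ℕ → E) (n : ℕ) :
    FiniteMeasure E :=
  ∑ i ∈ Finset.range n, (diracProba (x i)).toFiniteMeasure

/-- The renormalization `Θ_a(μ)` of a finite Borel measure `μ` on a real vector space: the image
of `μ` under `x ↦ x / a`. -/
noncomputable def renormalize {E : Type*} [MeasurableSpace E] [SMul ℝ E] (a : ℝ)
    (μ : FiniteMeasure E) : FiniteMeasure E :=
  μ.map fun x => a⁻¹ • x

open scoped Pointwise in
/-- The defining property of the renormalization: `Θ_a(μ)(B / a) = μ(B)`. -/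
theorem renormalize_apply {d : ℕ} {a : ℝ} (ha : 0 < a)
    (μ : FiniteMeasure (EuclideanSpace ℝ (Fin d))) {B : Set (EuclideanSpace ℝ (Fin d))}
    (hB : MeasurableSet B) : renormalize a μ (a⁻¹ • B) = μ B := by
  have ha' : a⁻¹ ≠ 0 := (inv_pos.mpr ha).ne'
  have hm : Measurable fun x : EuclideanSpace ℝ (Fin d) => a⁻¹ • x := measurable_const_smul _
  unfold renormalize
  rw [FiniteMeasure.map_apply μ hm (hB.const_smul_of_ne_zero ha')]
  congr 1
  rw [show (fun x : EuclideanSpace ℝ (Fin d) => a⁻¹ • x) ⁻¹' (a⁻¹ • B) = B from ?_]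
  rw [Set.preimage_smul₀ ha', inv_inv, smul_inv_smul₀ ha.ne']

/-! ### Characteristic functions: equicontinuity at the origin and almost everywhere convergence. -/

section CharFun

variable {E : Type*} [NormedAddCommGroup E] [InnerProductSpace ℝ E] [MeasurableSpace E]
  [BorelSpace E]

open scoped RealInnerProductSpace

/-! Fix `t`, let `φ` be the characteristic function of a displacement at `t`, and let `S n` be the
sum of `exp(i⟨X_j, t⟩)` over `j ≤ n`. A new ball copies a uniform earlier ball and adds an
independent displacement, so the conditional mean of `S (n+1)` is `(1 + φ/(n+1)) S n`. Hence `S n /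
a n` is a martingale, where `a n = urnFactor φ n`. Moreover `a n / (n+1)` is the product of the
factors `1 - (1-φ)/(j+2)`, roughly `φ ^ log n` when `φ` is near `1`. At the argument `t / (log n)^α`
this is the characteristic function of the normalized random walk after about `log n` steps, which
tends to that of `Λ`.

The difficulty is that the argument moves with `n`. It is frozen at `t / (k^4)^α` on the block where
`(log (n+1))^(1/4)` has integer part `k`. By `exists_eventually_mul_norm_charFun_sub_one_le`,
stability forces `1 - φ_k = O(k^(-4))`. The bound `integral_norm_div_sub_one_sq_le` gives `E|S n / a
n - 1|² = O(|1-φ|)` uniformly in `n`, so Doob's inequality controls a whole block: a squared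
deviation of at least `k^(-2)` has probability `O(k^(-2))`, and Borel–Cantelli applies
(`IsUrnSequence.ae_tendsto_average`).

This is almost sure convergence for each `t`. Fubini gives, almost surely, convergence for almost
every `t`; `tendsto_charFun_of_ae` extends it to all `t`, and Lévy's theorem gives weak convergence.
Since `log (n+1) / k^4` tends to `1`, the block scale may be replaced by the logarithm. -/

lemma norm_exp_ofReal_mul_I_sub_one_le (x : ℝ) :
    ‖Complex.exp (x * Complex.I) - 1‖ ≤ min 2 |x| := by
  refine le_min ?_ ?_
  · calc _ ≤ ‖Complex.exp (x * Complex.I)‖ + ‖(1 : ℂ)‖ := norm_sub_le _ _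
      _ = 2 := by rw [Complex.norm_exp_ofReal_mul_I]; norm_num
  · have := Real.norm_exp_I_mul_ofReal_sub_one_le (x := x)
    rwa [mul_comm, Real.norm_eq_abs] at this

/-- The integrand of the bound is bounded, continuous and independent of `u`, so the bound survives
weak limits uniformly over the ball. -/
lemma norm_charFun_sub_one_le [SecondCountableTopology E] (μ : Measure E) [IsProbabilityMeasure μ]
    {r : ℝ} {u : E} (hu : ‖u‖ ≤ r) : ‖charFun μ u - 1‖ ≤ ∫ x, min 2 (r * ‖x‖) ∂μ := by
  have hr : 0 ≤ r := (norm_nonneg u).trans hu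
  have hint : Integrable (fun x : E => Complex.exp (⟪x, u⟫ * Complex.I)) μ :=
    Integrable.of_bound (by fun_prop) 1
      (.of_forall fun x => (Complex.norm_exp_ofReal_mul_I _).le)
  have h : charFun μ u - 1 = ∫ x, (Complex.exp (⟪x, u⟫ * Complex.I) - 1) ∂μ := by
    rw [integral_sub hint (integrable_const _), charFun_apply]
    simp
  rw [h]
  refine norm_integral_le_of_norm_le ?_ (.of_forall fun x => ?_)
  · refine Integrable.of_bound (by fun_prop) 2 (.of_forall fun x => ?_)
    rw [Real.norm_eq_abs, abs_of_nonneg (by positivity)]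
    exact min_le_left _ _
  · refine (norm_exp_ofReal_mul_I_sub_one_le _).trans (min_le_min le_rfl ?_)
    calc |⟪x, u⟫| ≤ ‖x‖ * ‖u‖ := abs_real_inner_le_norm _ _
      _ ≤ ‖x‖ * r := by gcongr
      _ = r * ‖x‖ := mul_comm _ _

/-- Along a weakly convergent sequence, characteristic functions are equicontinuous at `0`. -/
lemma exists_eventually_norm_charFun_sub_one_le [SecondCountableTopology E]
    {ν : ℕ → ProbabilityMeasure E}
    {ν₀ : ProbabilityMeasure E} (h : Tendsto ν atTop (𝓝 ν₀)) {ε : ℝ} (hε : 0 < ε) :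
    ∃ r > 0, ∀ᶠ n in atTop, ∀ u : E, ‖u‖ ≤ r → ‖charFun (ν n : Measure E) u - 1‖ ≤ ε := by
  have hlim : Tendsto (fun k : ℕ => ∫ x, min 2 ((1 / ((k : ℝ) + 1)) * ‖x‖) ∂(ν₀ : Measure E))
      atTop (𝓝 (∫ _, (0 : ℝ) ∂(ν₀ : Measure E))) := by
    refine tendsto_integral_of_dominated_convergence (fun _ => 2) ?_ (integrable_const _) ?_ ?_
    · intro k; fun_prop
    · intro k
      refine .of_forall fun x => ?_
      rw [Real.norm_eq_abs, abs_of_nonneg (by positivity)]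
      exact min_le_left _ _
    · refine .of_forall fun x => ?_
      have h1 := (tendsto_one_div_add_atTop_nhds_zero_nat (𝕜 := ℝ)).mul_const ‖x‖
      have h2 := (tendsto_const_nhds (x := (2 : ℝ))).min h1
      simpa using h2
  rw [integral_zero] at hlim
  obtain ⟨k, hk⟩ := (hlim.eventually_lt_const hε).exists
  refine ⟨1 / ((k : ℝ) + 1), by positivity, ?_⟩
  -- `k` was chosen from the limit law alone; this single test function carries the strict
  -- inequality to `ν n` for all large `n`.
  let f : BoundedContinuousFunction E ℝ := BoundedContinuousFunction.ofNormedAddCommGroup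
    (fun x => min 2 ((1 / ((k : ℝ) + 1)) * ‖x‖)) (by fun_prop) 2 (fun x => by
      rw [Real.norm_eq_abs, abs_of_nonneg (by positivity)]
      exact min_le_left _ _)
  have hf := (ProbabilityMeasure.tendsto_iff_forall_integral_tendsto.1 h) f
  filter_upwards [hf.eventually_lt_const hk] with n hn u hu
  exact (norm_charFun_sub_one_le _ hu).trans hn.le

/-- Jensen's inequality, in the form of a nonnegative variance, combined with `|exp(ia) - exp(ib)|²
= 2 - 2 cos(a - b)`. Control near the origin thus becomes control of increments everywhere. -/
lemma norm_charFun_sub_sq_le [SecondCountableTopology E] (μ : Measure E) [IsProbabilityMeasure μ]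
    (s t : E) :
    ‖charFun μ t - charFun μ s‖ ^ 2 ≤ 2 * ‖charFun μ (t - s) - 1‖ := by
  have hint (u : E) : Integrable (fun x : E => Complex.exp (⟪x, u⟫ * Complex.I)) μ :=
    Integrable.of_bound (by fun_prop) 1
      (.of_forall fun x => (Complex.norm_exp_ofReal_mul_I _).le)
  have hb (x : E) : ‖Complex.exp (⟪x, t⟫ * Complex.I) - Complex.exp (⟪x, s⟫ * Complex.I)‖ ^ 2
      = 2 - 2 * (Complex.exp (⟪x, t - s⟫ * Complex.I)).re := by
    rw [inner_sub_right, ← Complex.normSq_eq_norm_sq, Complex.normSq_apply]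
    simp only [Complex.sub_re, Complex.sub_im, Complex.exp_ofReal_mul_I_re,
      Complex.exp_ofReal_mul_I_im, Real.cos_sub]
    nlinarith [Real.sin_sq_add_cos_sq ⟪x, t⟫, Real.sin_sq_add_cos_sq ⟪x, s⟫]
  have hmem : MemLp (fun x : E =>
      ‖Complex.exp (⟪x, t⟫ * Complex.I) - Complex.exp (⟪x, s⟫ * Complex.I)‖) 2 μ := by
    refine MemLp.of_bound (by fun_prop) 2 (.of_forall fun x => ?_)
    rw [norm_norm]
    refine (norm_sub_le _ _).trans ?_
    rw [Complex.norm_exp_ofReal_mul_I, Complex.norm_exp_ofReal_mul_I]; norm_num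
  have hvar := variance_nonneg (fun x : E =>
      ‖Complex.exp (⟪x, t⟫ * Complex.I) - Complex.exp (⟪x, s⟫ * Complex.I)‖) μ
  rw [variance_eq_sub hmem] at hvar
  have h1 : ‖charFun μ t - charFun μ s‖ ≤ ∫ x : E,
      ‖Complex.exp (⟪x, t⟫ * Complex.I) - Complex.exp (⟪x, s⟫ * Complex.I)‖ ∂μ := by
    rw [charFun_apply, charFun_apply, ← integral_sub (hint t) (hint s)]
    exact norm_integral_le_integral_norm _
  have h2 : ∫ x : E,
      ‖Complex.exp (⟪x, t⟫ * Complex.I) - Complex.exp (⟪x, s⟫ * Complex.I)‖ ^ 2 ∂μ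
      = 2 * (1 - charFun μ (t - s)).re := by
    simp_rw [hb]
    have hre := integral_re (hint (t - s))
    have hint' := (hint (t - s)).re
    simp only [RCLike.re_to_complex] at hre hint'
    rw [integral_sub (integrable_const _) (hint'.const_mul 2), integral_const_mul, hre,
      ← charFun_apply]
    simp; ring
  have h3 : (1 - charFun μ (t - s)).re ≤ ‖charFun μ (t - s) - 1‖ := by
    rw [norm_sub_rev]; exact Complex.re_le_norm _
  simp only [Pi.pow_apply] at hvar
  rw [h2] at hvar
  have h4 := pow_le_pow_left₀ (norm_nonneg _) h1 2
  linarith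

/-- Almost everywhere convergence of characteristic functions to a characteristic function
is convergence everywhere. -/
lemma tendsto_charFun_of_ae [FiniteDimensional ℝ E] {ν : ℕ → ProbabilityMeasure E}
    {ν₀ : ProbabilityMeasure E}
    (h : ∀ᵐ t : E, Tendsto (fun n => charFun (ν n : Measure E) t) atTop
      (𝓝 (charFun (ν₀ : Measure E) t))) (t : E) :
    Tendsto (fun n => charFun (ν n : Measure E) t) atTop (𝓝 (charFun (ν₀ : Measure E) t)) := by
  -- Almost every `u` is good together with `u + t`, so such `u` exist arbitrarily close to `0`; the
  -- increment from `t` to `u + t` is then controlled by the value at `u`.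
  have h' : ∀ᵐ u : E, Tendsto (fun n => charFun (ν n : Measure E) (u + t)) atTop
      (𝓝 (charFun (ν₀ : Measure E) (u + t))) :=
    (measurePreserving_add_right volume t).quasiMeasurePreserving.ae h
  have hd := Measure.dense_of_ae (h.and h')
  have hc : Continuous (charFun (ν₀ : Measure E)) := continuous_charFun
  have hc0 : charFun (ν₀ : Measure E) 0 = 1 := by simp
  rw [Metric.tendsto_atTop]
  intro ε hε
  have hU : IsOpen {u : E | 2 * ‖charFun (ν₀ : Measure E) u - 1‖ < (ε / 3) ^ 2 ∧
      ‖charFun (ν₀ : Measure E) (u + t) - charFun (ν₀ : Measure E) t‖ < ε / 3} := by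
    rw [Set.ofPred_and]
    exact (isOpen_lt (by fun_prop) continuous_const).inter
      (isOpen_lt (by fun_prop) continuous_const)
  obtain ⟨u, ⟨hu1, hu2⟩, hu3, hu4⟩ := hd.exists_mem_open hU ⟨0, by
    simp only [Set.mem_ofPred_eq, hc0, zero_add, sub_self, norm_zero, mul_zero]
    exact ⟨by positivity, by positivity⟩⟩
  have e1 : ∀ᶠ n in atTop, 2 * ‖charFun (ν n : Measure E) u - 1‖ < (ε / 3) ^ 2 :=
    (((hu1.sub_const 1).norm).const_mul 2).eventually_lt_const hu3
  have e2 : ∀ᶠ n in atTop,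
      ‖charFun (ν n : Measure E) (u + t) - charFun (ν₀ : Measure E) t‖ < ε / 3 :=
    ((hu2.sub_const _).norm).eventually_lt_const hu4
  refine eventually_atTop.1 ?_
  filter_upwards [e1, e2] with n h1 h2
  have h3 := norm_charFun_sub_sq_le (ν n : Measure E) t (u + t)
  rw [add_sub_cancel_right] at h3
  have h4 : ‖charFun (ν n : Measure E) (u + t) - charFun (ν n : Measure E) t‖ < ε / 3 :=
    lt_of_pow_lt_pow_left₀ 2 (by positivity) (h3.trans_lt h1)
  rw [dist_eq_norm]
  calc _ = ‖(charFun (ν n : Measure E) (u + t) - charFun (ν₀ : Measure E) t) -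
        (charFun (ν n : Measure E) (u + t) - charFun (ν n : Measure E) t)‖ := by congr 1; ring
    _ ≤ _ := norm_sub_le _ _
    _ < ε := by linarith

lemma tendsto_charFun_smul [FiniteDimensional ℝ E] {ν : ℕ → ProbabilityMeasure E}
    {ν₀ : ProbabilityMeasure E} (h : Tendsto ν atTop (𝓝 ν₀)) {c : ℕ → ℝ}
    (hc : Tendsto c atTop (𝓝 1)) (t : E) :
    Tendsto (fun n => charFun (ν n : Measure E) (c n • t)) atTop
      (𝓝 (charFun (ν₀ : Measure E) t)) := by
  have h0 := ProbabilityMeasure.tendsto_iff_tendsto_charFun.1 h t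
  have hd : Tendsto (fun n => charFun (ν n : Measure E) (c n • t) - charFun (ν n : Measure E) t)
      atTop (𝓝 0) := by
    rw [Metric.tendsto_nhds]
    intro ε hε
    obtain ⟨r, hr, hev⟩ := exists_eventually_norm_charFun_sub_one_le h (ε := ε ^ 2 / 4)
      (by positivity)
    have hs : Tendsto (fun n => ‖c n • t - t‖) atTop (𝓝 0) := by
      simpa using ((hc.smul_const t).sub_const t).norm
    filter_upwards [hev, hs.eventually_le_const hr] with n h1 h2
    rw [dist_zero_right]
    refine lt_of_pow_lt_pow_left₀ 2 hε.le
      ((norm_charFun_sub_sq_le (ν n : Measure E) t (c n • t)).trans_lt ?_)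
    have := h1 _ h2
    nlinarith [pow_pos hε 2]
  simpa using hd.add h0

end CharFun

/-! ### Powers of complex numbers close to 1. -/

/-- Only binomial terms of order at least two remain, with nonnegative coefficients, so `‖z‖`
majorizes `z`. -/
lemma norm_one_add_pow_sub_le (z : ℂ) (n : ℕ) :
    ‖(1 + z) ^ n - 1 - n * z‖ ≤ (1 + ‖z‖) ^ n - 1 - n * ‖z‖ := by
  induction n with
  | zero => simp
  | succ n ih =>
    calc ‖(1 + z) ^ (n + 1) - 1 - (n + 1 : ℕ) * z‖
        = ‖(1 + z) * ((1 + z) ^ n - 1 - n * z) + n * z ^ 2‖ := by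
          congr 1; push_cast; ring
      _ ≤ (1 + ‖z‖) * ((1 + ‖z‖) ^ n - 1 - n * ‖z‖) + n * ‖z‖ ^ 2 := by
          refine (norm_add_le _ _).trans (add_le_add ?_ ?_)
          · rw [norm_mul]
            refine mul_le_mul ?_ ih (norm_nonneg _) (by positivity)
            simpa using norm_add_le (1 : ℂ) z
          · simp
      _ = _ := by push_cast; ring

lemma norm_one_add_pow_sub_le_sq {z : ℂ} {n : ℕ} (h : n * ‖z‖ ≤ 1) :
    ‖(1 + z) ^ n - 1 - n * z‖ ≤ (n * ‖z‖) ^ 2 := by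
  refine (norm_one_add_pow_sub_le z n).trans ?_
  have h1 : (1 + ‖z‖) ^ n ≤ Real.exp (n * ‖z‖) := by
    rw [Real.exp_nat_mul]
    gcongr
    rw [add_comm]; exact Real.add_one_le_exp _
  have h2 := Real.abs_exp_sub_one_sub_id_le (x := n * ‖z‖)
    (by rwa [abs_of_nonneg (by positivity)])
  linarith [le_abs_self (Real.exp (n * ‖z‖) - 1 - n * ‖z‖)]

/-- If the `n`-th power of a path starting at `1` stays near `1`, then the path stays within
distance `O(1 / n)` of `1`. -/
lemma mul_norm_sub_one_le_half_of_path {g : ℝ → ℂ} (hg : Continuous g) (h0 : g 0 = 1) {n : ℕ}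
    (h : ∀ τ ∈ Set.Icc (0 : ℝ) 1, ‖g τ ^ n - 1‖ ≤ 1 / 8) : n * ‖g 1 - 1‖ ≤ 1 / 2 := by
  by_contra! hlt
  have hc : ContinuousOn (fun τ => (n : ℝ) * ‖g τ - 1‖) (Set.Icc 0 1) := by fun_prop
  -- At a point where `n * ‖g τ - 1‖` equals `1/2`, the quadratic error is at most `1/4`, so `g τ ^
  -- n` is at distance at least `1/4` from `1`, contradicting the bound `1/8`.
  obtain ⟨τ, hτ, hτ'⟩ := intermediate_value_Icc zero_le_one hc
    (show (1 / 2 : ℝ) ∈ Set.Icc _ _ from ⟨by simp [h0], hlt.le⟩)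
  simp only at hτ'
  have h1 := norm_one_add_pow_sub_le_sq (z := g τ - 1) (n := n) (by rw [hτ']; norm_num)
  rw [hτ', add_sub_cancel] at h1
  have h2 := h τ hτ
  have h3 : (1 / 2 : ℝ) = ‖(n : ℂ) * (g τ - 1)‖ := by simp [← hτ']
  have h4 : ‖(n : ℂ) * (g τ - 1)‖ ≤ ‖g τ ^ n - 1‖ + ‖g τ ^ n - 1 - n * (g τ - 1)‖ := by
    have := norm_sub_le (g τ ^ n - 1) (g τ ^ n - 1 - n * (g τ - 1))
    rwa [sub_sub_cancel] at this
  norm_num at h1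
  linarith

/-! ### The rate at which the characteristic function of a displacement approaches 1. -/

section Stable

variable {E : Type*} [NormedAddCommGroup E] [InnerProductSpace ℝ E] [MeasurableSpace E]
  [BorelSpace E] [FiniteDimensional ℝ E]

/-- If the laws `ν n`, with characteristic functions `t ↦ φ (t / n ^ α) ^ n`, converge weakly, then
`φ (t / n ^ α) = 1 + O(1 / n)`. -/
lemma exists_eventually_mul_norm_charFun_sub_one_le {μ : ProbabilityMeasure E}
    {ν : ℕ → ProbabilityMeasure E} {ν₀ : ProbabilityMeasure E} {α : ℝ} (hα : 0 < α)
    (hν : Tendsto ν atTop (𝓝 ν₀))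
    (hμν : ∀ n t, charFun (ν n : Measure E) t =
      charFun (μ : Measure E) (((n : ℝ) ^ α)⁻¹ • t) ^ n) (t : E) :
    ∃ C : ℝ, ∀ᶠ n : ℕ in atTop,
      n * ‖charFun (μ : Measure E) (((n : ℝ) ^ α)⁻¹ • t) - 1‖ ≤ C := by
  obtain ⟨r, hr, hev⟩ := exists_eventually_norm_charFun_sub_one_le hν (ε := 1 / 8) (by norm_num)
  have key : ∀ᶠ n : ℕ in atTop, ∀ u : E, ‖u‖ ≤ r →
      n * ‖charFun (μ : Measure E) (((n : ℝ) ^ α)⁻¹ • u) - 1‖ ≤ 1 / 2 := by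
    filter_upwards [hev] with n hn u hu
    have hc : Continuous (charFun (μ : Measure E)) := continuous_charFun
    have := mul_norm_sub_one_le_half_of_path (n := n)
      (g := fun τ : ℝ => charFun (μ : Measure E) (((n : ℝ) ^ α)⁻¹ • (τ • u))) (by fun_prop)
      (by simp) (fun τ hτ => by
        rw [← hμν]
        refine hn _ ?_
        rw [norm_smul, Real.norm_eq_abs, abs_of_nonneg hτ.1]
        nlinarith [hτ.2, norm_nonneg u])
    simpa using this
  obtain ⟨N, hN⟩ := eventually_atTop.1 key
  have hlim : Tendsto (fun R : ℕ => ((R : ℝ) ^ α)⁻¹ * ‖t‖) atTop (𝓝 0) := by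
    have := ((tendsto_rpow_atTop hα).comp tendsto_natCast_atTop_atTop).inv_tendsto_atTop
    simpa using this.mul_const ‖t‖
  -- Scaling by `R ^ α` brings `t` into the ball of radius `r`. The estimate at time `m = n / R`
  -- then applies, and `n ≤ 2 * R * m` turns its bound `1/2` into `R`.
  obtain ⟨R, hR, hR1⟩ := ((hlim.eventually_le_const hr).and (eventually_ge_atTop 1)).exists
  refine ⟨R, ?_⟩
  filter_upwards [eventually_ge_atTop ((N + 1) * R)] with n hn
  set m := n / R with hm
  have hR0 : 0 < R := hR1
  have hmN : N + 1 ≤ m := (Nat.le_div_iff_mul_le hR0).2 hn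
  have hm0 : (0 : ℝ) < m := by exact_mod_cast (by lia : 0 < m)
  have hRr : (0 : ℝ) < R := by exact_mod_cast hR0
  have hmR : (m : ℝ) * R ≤ n := by exact_mod_cast Nat.div_mul_le_self n R
  have hn0 : (0 : ℝ) < n := by nlinarith
  have hnm : (n : ℝ) ≤ 2 * R * m := by
    have h1 := Nat.lt_div_mul_add hR0 (a := n)
    rw [← hm] at h1
    have h2 : (n : ℝ) ≤ m * R + R := by exact_mod_cast h1.le
    have h3 : (1 : ℝ) ≤ m := by exact_mod_cast (by lia : 1 ≤ m)
    nlinarith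
  have hsm : ((n : ℝ) ^ α)⁻¹ • t = ((m : ℝ) ^ α)⁻¹ • (((m : ℝ) / n) ^ α • t) := by
    rw [smul_smul, Real.div_rpow hm0.le hn0.le]
    congr 1
    have : (m : ℝ) ^ α ≠ 0 := by positivity
    field_simp
  have hle : ‖((m : ℝ) / n) ^ α • t‖ ≤ r := by
    rw [norm_smul, Real.norm_eq_abs, abs_of_nonneg (by positivity)]
    refine le_trans ?_ hR
    gcongr
    rw [← Real.inv_rpow hRr.le]
    gcongr
    rw [div_le_iff₀ hn0, inv_mul_eq_div, le_div_iff₀ hRr]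
    exact hmR
  have h1 := hN m (by lia) _ hle
  rw [← hsm] at h1
  calc _ ≤ 2 * R * m * ‖charFun (μ : Measure E) (((n : ℝ) ^ α)⁻¹ • t) - 1‖ := by gcongr
    _ = 2 * R * (m * ‖charFun (μ : Measure E) (((n : ℝ) ^ α)⁻¹ • t) - 1‖) := by ring
    _ ≤ 2 * R * (1 / 2) := by gcongr
    _ = R := by ring

end Stable

/-! ### Size and asymptotics of the growth factor. -/

section UrnProduct

/-- The expected growth factor `∏ j < n, (1 + φ / (j + 1))` of the martingale of the urn. -/
noncomputable def urnFactor (φ : ℂ) (n : ℕ) : ℂ := ∏ j ∈ Finset.range n, (1 + φ / ((j : ℂ) + 1))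

lemma urnFactor_succ (φ : ℂ) (n : ℕ) :
    urnFactor φ (n + 1) = urnFactor φ n * (1 + φ / ((n : ℂ) + 1)) := Finset.prod_range_succ _ _

/-- The factors `(j + 2) / (j + 1)`, which correspond to `φ = 1`, telescope to `n + 1`. -/
lemma urnFactor_eq (φ : ℂ) (n : ℕ) :
    urnFactor φ n = (n + 1) * ∏ j ∈ Finset.range n, (1 - (1 - φ) / ((j : ℂ) + 2)) := by
  induction n with
  | zero => simp [urnFactor]
  | succ n ih =>
    rw [urnFactor_succ, ih, Finset.prod_range_succ]
    have h1 : (n : ℂ) + 1 ≠ 0 := by exact_mod_cast n.succ_ne_zero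
    have h2 : (n : ℂ) + 2 ≠ 0 := by exact_mod_cast (n + 1).succ_ne_zero
    push_cast
    field_simp
    ring

lemma one_sub_norm_mul_sum_le (δ : ℂ) (hδ : ‖δ‖ ≤ 1) (n : ℕ) :
    1 - ‖δ‖ * ∑ j ∈ Finset.range n, 1 / ((j : ℝ) + 2) ≤
      ‖∏ j ∈ Finset.range n, (1 - δ / ((j : ℂ) + 2))‖ := by
  induction n with
  | zero => simp
  | succ n ih =>
    rw [Finset.prod_range_succ, Finset.sum_range_succ, norm_mul]
    have h0 : ‖δ / ((n : ℂ) + 2)‖ = ‖δ‖ * (1 / ((n : ℝ) + 2)) := by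
      rw [norm_div, ← Nat.cast_ofNat (R := ℂ), ← Nat.cast_add, Complex.norm_natCast]
      push_cast; ring
    have h1 : 1 - ‖δ‖ * (1 / ((n : ℝ) + 2)) ≤ ‖1 - δ / ((n : ℂ) + 2)‖ := by
      have := norm_sub_norm_le (1 : ℂ) (δ / ((n : ℂ) + 2))
      rwa [h0, norm_one] at this
    have hs : 0 ≤ ∑ j ∈ Finset.range n, 1 / ((j : ℝ) + 2) :=
      Finset.sum_nonneg fun j _ => by positivity
    have hx : 1 / ((n : ℝ) + 2) ≤ 1 := by
      rw [div_le_one (by positivity)]; linarith [(n.cast_nonneg : (0 : ℝ) ≤ n)]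
    have hx0 : 0 ≤ 1 / ((n : ℝ) + 2) := by positivity
    set x := 1 / ((n : ℝ) + 2)
    set S := ∑ j ∈ Finset.range n, 1 / ((j : ℝ) + 2)
    set p := ‖∏ j ∈ Finset.range n, (1 - δ / ((j : ℂ) + 2))‖
    have hd := norm_nonneg δ
    have h2 : 0 ≤ 1 - ‖δ‖ * x := by nlinarith
    calc 1 - ‖δ‖ * (S + x) ≤ (1 - ‖δ‖ * S) * (1 - ‖δ‖ * x) := by
          nlinarith [mul_nonneg (mul_nonneg hd hs) (mul_nonneg hd hx0)]
      _ ≤ p * (1 - ‖δ‖ * x) := by gcongr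
      _ ≤ _ := by gcongr

/-- Each factor has modulus at least `1 + (3/4)/(j+1)`, which Bernoulli's inequality for the concave
power `3/4` bounds below by `((j+2)/(j+1))^(3/4)`. -/
lemma rpow_le_norm_urnFactor {φ : ℂ} (hφ : ‖1 - φ‖ ≤ 1 / 4) (n : ℕ) :
    ((n : ℝ) + 1) ^ (3 / 4 : ℝ) ≤ ‖urnFactor φ n‖ := by
  induction n with
  | zero => simp [urnFactor]
  | succ n ih =>
    rw [urnFactor_succ, norm_mul]
    have hn : (0 : ℝ) < (n : ℝ) + 1 := by positivity
    have h0 : ‖(1 - φ) / ((n : ℂ) + 1)‖ ≤ 1 / 4 / ((n : ℝ) + 1) := by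
      rw [norm_div, ← Nat.cast_add_one, Complex.norm_natCast]
      push_cast
      gcongr
    have h1 : 1 + (3 / 4) * (1 / ((n : ℝ) + 1)) ≤ ‖1 + φ / ((n : ℂ) + 1)‖ := by
      have h2 := norm_sub_norm_le (1 + 1 / ((n : ℂ) + 1)) ((1 - φ) / ((n : ℂ) + 1))
      have h3 : ‖1 + 1 / ((n : ℂ) + 1)‖ = 1 + 1 / ((n : ℝ) + 1) := by
        have : (1 + 1 / ((n : ℂ) + 1)) = ((1 + 1 / ((n : ℝ) + 1) : ℝ) : ℂ) := by push_cast; ring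
        rw [this, Complex.norm_real, Real.norm_eq_abs, abs_of_nonneg (by positivity)]
      have h4 : 1 + 1 / ((n : ℂ) + 1) - (1 - φ) / ((n : ℂ) + 1) = 1 + φ / ((n : ℂ) + 1) := by ring
      rw [h3, h4] at h2
      have h5 : (1 : ℝ) / ((n : ℝ) + 1) - 1 / 4 / ((n : ℝ) + 1)
        = (3 / 4) * (1 / ((n : ℝ) + 1)) := by ring
      linarith
    have hb := rpow_one_add_le_one_add_mul_self (s := 1 / ((n : ℝ) + 1)) (p := 3 / 4)
      (by have : 0 < 1 / ((n : ℝ) + 1) := by positivity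
          linarith) (by norm_num) (by norm_num)
    calc (((n + 1 : ℕ) : ℝ) + 1) ^ (3 / 4 : ℝ)
        = ((n : ℝ) + 1) ^ (3 / 4 : ℝ) * (1 + 1 / ((n : ℝ) + 1)) ^ (3 / 4 : ℝ) := by
          rw [← Real.mul_rpow hn.le (by positivity)]
          congr 1
          push_cast
          field_simp
      _ ≤ _ := by
          gcongr
          exact hb.trans h1

lemma sum_one_div_add_two_eq (n : ℕ) :
    ∑ j ∈ Finset.range n, 1 / ((j : ℝ) + 2) = (harmonic (n + 1) : ℝ) - 1 := by
  rw [harmonic, Finset.sum_range_succ']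
  push_cast
  simp [add_assoc, one_add_one_eq_two]

lemma sum_one_div_add_two_le (n : ℕ) :
    ∑ j ∈ Finset.range n, 1 / ((j : ℝ) + 2) ≤ Real.log ((n : ℝ) + 1) := by
  rw [sum_one_div_add_two_eq]
  have := harmonic_le_one_add_log (n + 1)
  push_cast at this ⊢
  linarith

lemma log_sub_one_le_sum_one_div_add_two (n : ℕ) :
    Real.log ((n : ℝ) + 1) - 1 ≤ ∑ j ∈ Finset.range n, 1 / ((j : ℝ) + 2) := by
  rw [sum_one_div_add_two_eq]
  have := log_add_one_le_harmonic (n + 1)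
  have h2 : Real.log ((n : ℝ) + 1) ≤ Real.log (((n + 1 : ℕ) : ℝ) + 1) :=
    Real.log_le_log (by positivity) (by push_cast; linarith)
  push_cast at this h2 ⊢
  linarith

lemma norm_log_one_sub_add_le {z : ℂ} (hz : ‖z‖ ≤ 1 / 2) : ‖Complex.log (1 - z) + z‖ ≤ ‖z‖ ^ 2 := by
  have h := Complex.norm_log_one_add_sub_self_le (z := -z) (by rw [norm_neg]; linarith)
  rw [norm_neg, sub_neg_eq_add, ← sub_eq_add_neg] at h
  refine h.trans ?_
  have : (1 - ‖z‖)⁻¹ ≤ 2 := by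
    rw [inv_le_comm₀ (by linarith) (by norm_num)]; linarith
  nlinarith [sq_nonneg ‖z‖, mul_le_mul_of_nonneg_left this (sq_nonneg ‖z‖)]

/-- Since `log (1 - z) = -z + O(z²)`, the product and the power have logarithms near `-δ` times the
harmonic sum and `-δ m`; `x` is the difference of the logarithms. -/
lemma prod_one_sub_div_eq_pow_mul_exp {δ : ℂ} (hδ : ‖δ‖ ≤ 1 / 2) (m n : ℕ) :
    ∃ x : ℂ, ∏ j ∈ Finset.range n, (1 - δ / ((j : ℂ) + 2)) = (1 - δ) ^ m * Complex.exp x ∧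
      ‖x‖ ≤ ‖δ‖ ^ 2 * (∑ j ∈ Finset.range n, 1 / ((j : ℝ) + 2)) + m * ‖δ‖ ^ 2 +
        ‖δ‖ * |(∑ j ∈ Finset.range n, 1 / ((j : ℝ) + 2)) - m| := by
  have hnorm (j : ℕ) : ‖δ / ((j : ℂ) + 2)‖ = ‖δ‖ * (1 / ((j : ℝ) + 2)) := by
    rw [norm_div, ← Nat.cast_ofNat (R := ℂ), ← Nat.cast_add, Complex.norm_natCast]
    push_cast; ring
  have hle1 (j : ℕ) : 1 / ((j : ℝ) + 2) ≤ 1 := by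
    rw [div_le_one (by positivity)]; linarith [(j.cast_nonneg : (0 : ℝ) ≤ j)]
  have hpos (j : ℕ) : 0 < 1 / ((j : ℝ) + 2) := by positivity
  have hle (j : ℕ) : ‖δ / ((j : ℂ) + 2)‖ ≤ 1 / 2 := by
    rw [hnorm]
    nlinarith [norm_nonneg δ, hle1 j, hpos j]
  have hne {z : ℂ} (hz : ‖z‖ ≤ 1 / 2) : 1 - z ≠ 0 := by
    intro h
    rw [sub_eq_zero] at h
    rw [← h, norm_one] at hz
    norm_num at hz
  refine ⟨(∑ j ∈ Finset.range n, Complex.log (1 - δ / ((j : ℂ) + 2))) - m * Complex.log (1 - δ),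
    ?_, ?_⟩
  · rw [Complex.exp_sub, Complex.exp_sum, Complex.exp_nat_mul, Complex.exp_log (hne hδ),
      mul_div_cancel₀ _ (pow_ne_zero _ (hne hδ))]
    exact Finset.prod_congr rfl fun j _ => (Complex.exp_log (hne (hle j))).symm
  · set S := ∑ j ∈ Finset.range n, 1 / ((j : ℝ) + 2) with hS
    have hdec : (∑ j ∈ Finset.range n, Complex.log (1 - δ / ((j : ℂ) + 2))) -
        m * Complex.log (1 - δ) =
        (∑ j ∈ Finset.range n, (Complex.log (1 - δ / ((j : ℂ) + 2)) + δ / ((j : ℂ) + 2))) -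
        m * (Complex.log (1 - δ) + δ) - δ * ((S - m : ℝ) : ℂ) := by
      rw [Finset.sum_add_distrib, hS]
      push_cast
      simp_rw [div_eq_mul_inv δ, ← Finset.mul_sum, one_div]
      ring
    rw [hdec]
    refine (norm_sub_le _ _).trans (add_le_add ((norm_sub_le _ _).trans (add_le_add ?_ ?_)) ?_)
    · rw [hS, Finset.mul_sum]
      refine norm_sum_le_of_le _ fun j _ => (norm_log_one_sub_add_le (hle j)).trans ?_
      rw [hnorm, mul_pow]
      gcongr
      nlinarith [hle1 j, hpos j]
    · rw [norm_mul, Complex.norm_natCast]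
      gcongr
      exact norm_log_one_sub_add_le hδ
    · rw [norm_mul, Complex.norm_real, Real.norm_eq_abs]

/-- The harmonic sum is asymptotic to `m n` and `δ n` is `O(1 / m n)`, so the exponential correction
tends to `1`. -/
lemma tendsto_prod_one_sub_div {δ : ℕ → ℂ} {m : ℕ → ℕ} {C : ℝ} {ℓ : ℂ}
    (hm : Tendsto m atTop atTop) (hδ : ∀ᶠ n in atTop, m n * ‖δ n‖ ≤ C)
    (hlog : Tendsto (fun n : ℕ => Real.log ((n : ℝ) + 1) / m n) atTop (𝓝 1))
    (hpow : Tendsto (fun n => (1 - δ n) ^ m n) atTop (𝓝 ℓ)) :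
    Tendsto (fun n => ∏ j ∈ Finset.range n, (1 - δ n / ((j : ℂ) + 2))) atTop (𝓝 ℓ) := by
  set S : ℕ → ℝ := fun n => ∑ j ∈ Finset.range n, 1 / ((j : ℝ) + 2) with hS
  have hmr : Tendsto (fun n => (m n : ℝ)) atTop atTop := tendsto_natCast_atTop_atTop.comp hm
  have hminv : Tendsto (fun n => (m n : ℝ)⁻¹) atTop (𝓝 0) := hmr.inv_tendsto_atTop
  have hSm : Tendsto (fun n => S n / m n) atTop (𝓝 1) := by
    have h1 : Tendsto (fun n : ℕ => (Real.log ((n : ℝ) + 1) - 1) / m n) atTop (𝓝 1) := by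
      simpa [sub_div] using hlog.sub hminv
    refine tendsto_of_tendsto_of_tendsto_of_le_of_le h1 hlog (fun n => ?_) (fun n => ?_)
    · exact div_le_div_of_nonneg_right (log_sub_one_le_sum_one_div_add_two n) (by positivity)
    · exact div_le_div_of_nonneg_right (sum_one_div_add_two_le n) (by positivity)
  have hδ' : ∀ᶠ n in atTop, ‖δ n‖ ≤ C * (m n : ℝ)⁻¹ := by
    filter_upwards [hδ, hmr.eventually_gt_atTop 0] with n h1 h2
    rw [← div_eq_mul_inv, le_div_iff₀ h2]; linarith
  have hhalf : ∀ᶠ n in atTop, ‖δ n‖ ≤ 1 / 2 := by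
    have h0 : Tendsto (fun n => C * (m n : ℝ)⁻¹) atTop (𝓝 0) := by
      simpa using hminv.const_mul C
    filter_upwards [hδ', h0.eventually_le_const (show (0 : ℝ) < 1 / 2 by norm_num)] with n h1 h2
    exact h1.trans h2
  have hx : ∀ n, ∃ x : ℂ, ‖δ n‖ ≤ 1 / 2 →
      ∏ j ∈ Finset.range n, (1 - δ n / ((j : ℂ) + 2)) = (1 - δ n) ^ m n * Complex.exp x ∧
      ‖x‖ ≤ ‖δ n‖ ^ 2 * S n + m n * ‖δ n‖ ^ 2 + ‖δ n‖ * |S n - m n| := fun n => by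
    by_cases h : ‖δ n‖ ≤ 1 / 2
    · obtain ⟨x, hx⟩ := prod_one_sub_div_eq_pow_mul_exp h (m n) n
      exact ⟨x, fun _ => hx⟩
    · exact ⟨0, fun h' => absurd h' h⟩
  choose x hx using hx
  have hx0 : Tendsto x atTop (𝓝 0) := by
    rw [tendsto_zero_iff_norm_tendsto_zero]
    have hb : Tendsto (fun n => C ^ 2 * (m n : ℝ)⁻¹ * (S n / m n) + C ^ 2 * (m n : ℝ)⁻¹ +
        C * |S n / m n - 1|) atTop (𝓝 0) := by
      have := (((hminv.const_mul (C ^ 2)).mul hSm).add (hminv.const_mul (C ^ 2))).add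
        ((hSm.sub_const 1).abs.const_mul C)
      simpa using this
    refine squeeze_zero' (.of_forall fun n => norm_nonneg _) ?_ hb
    filter_upwards [hhalf, hδ', hmr.eventually_gt_atTop 0] with n h1 h2 h3
    refine (hx n h1).2.trans ?_
    have hSn : 0 ≤ S n := Finset.sum_nonneg fun j _ => by positivity
    have hsq : ‖δ n‖ ^ 2 ≤ (C * (m n : ℝ)⁻¹) ^ 2 := by gcongr
    refine add_le_add (add_le_add ?_ ?_) ?_
    · calc _ ≤ (C * (m n : ℝ)⁻¹) ^ 2 * S n := by gcongr
        _ = _ := by ring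
    · calc _ ≤ m n * (C * (m n : ℝ)⁻¹) ^ 2 := by gcongr
        _ = _ := by field_simp
    · calc _ ≤ C * (m n : ℝ)⁻¹ * |S n - m n| := by gcongr
        _ = C * |S n / m n - 1| := by
          rw [div_sub_one h3.ne', abs_div, abs_of_pos h3]
          ring
  have hlim : Tendsto (fun n => (1 - δ n) ^ m n * Complex.exp (x n)) atTop (𝓝 ℓ) := by
    simpa using hpow.mul ((Complex.continuous_exp.tendsto 0).comp hx0)
  refine hlim.congr' ?_
  filter_upwards [hhalf] with n hn
  exact (hx n hn).1.symm

end UrnProduct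

/-! ### The martingale of the urn: second moments and maximal inequality. -/

section Martingale

open ComplexConjugate

variable {Ω : Type*} {mΩ : MeasurableSpace Ω}

/-- A sequence of complex numbers of modulus `1` in which each new term is, in conditional mean,
`φ` times a uniformly chosen earlier term. -/
structure IsUrnSequence (P : Measure Ω) (𝒢 : Filtration ℕ mΩ) (φ : ℂ) (e : ℕ → Ω → ℂ) : Prop where
  stronglyMeasurable : ∀ n, StronglyMeasurable[𝒢 n] (e n)
  norm_eq_one : ∀ n ω, ‖e n ω‖ = 1
  integral_zero : ∫ ω, e 0 ω ∂P = φ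
  integral_mul_succ : ∀ (n : ℕ) (Z : Ω → ℂ) (C : ℝ), StronglyMeasurable[𝒢 n] Z →
    (∀ ω, ‖Z ω‖ ≤ C) → ∫ ω, Z ω * e (n + 1) ω ∂P =
      φ / ((n : ℂ) + 1) * ∫ ω, Z ω * ∑ i ∈ Finset.range (n + 1), e i ω ∂P

namespace IsUrnSequence

variable {P : Measure Ω} {𝒢 : Filtration ℕ mΩ} {φ : ℂ} {e : ℕ → Ω → ℂ}

lemma stronglyMeasurable_sum (h : IsUrnSequence P 𝒢 φ e) (n : ℕ) :
    StronglyMeasurable[𝒢 n] fun ω => ∑ i ∈ Finset.range (n + 1), e i ω :=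
  Finset.stronglyMeasurable_fun_sum _ fun i hi =>
    (h.stronglyMeasurable i).mono (𝒢.mono (Nat.lt_succ_iff.1 (Finset.mem_range.1 hi)))

lemma norm_sum_le (h : IsUrnSequence P 𝒢 φ e) (n : ℕ) (ω : Ω) :
    ‖∑ i ∈ Finset.range (n + 1), e i ω‖ ≤ n + 1 := by
  refine (_root_.norm_sum_le _ _).trans ?_
  simp [h.norm_eq_one]

variable [IsProbabilityMeasure P]

lemma norm_factor_le_one (h : IsUrnSequence P 𝒢 φ e) : ‖φ‖ ≤ 1 := by
  rw [← h.integral_zero]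
  refine (norm_integral_le_of_norm_le_const (C := 1) (.of_forall fun ω => ?_)).trans ?_
  · exact (h.norm_eq_one 0 ω).le
  · simp

lemma integral_sum (h : IsUrnSequence P 𝒢 φ e) (n : ℕ) :
    ∫ ω, ∑ i ∈ Finset.range (n + 1), e i ω ∂P = urnFactor φ n * φ := by
  induction n with
  | zero => simp [urnFactor, h.integral_zero]
  | succ n ih =>
    simp_rw [Finset.sum_range_succ _ (n + 1)]
    have h1 := h.integral_mul_succ n (fun _ => 1) 1 stronglyMeasurable_const (by simp)
    simp only [one_mul] at h1
    rw [integral_add, h1, ih, urnFactor_succ]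
    · ring
    · exact Integrable.of_bound ((h.stronglyMeasurable_sum n).mono (𝒢.le n)).aestronglyMeasurable _
        (.of_forall fun ω => h.norm_sum_le n ω)
    · exact Integrable.of_bound
        ((h.stronglyMeasurable (n + 1)).mono (𝒢.le _)).aestronglyMeasurable 1
        (.of_forall fun ω => (h.norm_eq_one _ ω).le)

lemma integrable_norm_sum_sq (h : IsUrnSequence P 𝒢 φ e) (n : ℕ) :
    Integrable (fun ω => ‖∑ i ∈ Finset.range (n + 1), e i ω‖ ^ 2) P := by
  have hm := ((h.stronglyMeasurable_sum n).mono (𝒢.le n)).norm.pow 2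
  refine Integrable.of_bound hm.aestronglyMeasurable (((n : ℝ) + 1) ^ 2) (.of_forall fun ω => ?_)
  rw [norm_pow, norm_norm]
  gcongr
  exact h.norm_sum_le n ω

/-- Expand the square; the cross term is the defining identity tested against the conjugate of the
current sum, and the new term has modulus `1`. -/
lemma integral_norm_sum_sq_succ (h : IsUrnSequence P 𝒢 φ e) (n : ℕ) :
    ∫ ω, ‖∑ i ∈ Finset.range (n + 1 + 1), e i ω‖ ^ 2 ∂P =
      (1 + 2 * φ.re / ((n : ℝ) + 1)) * ∫ ω, ‖∑ i ∈ Finset.range (n + 1), e i ω‖ ^ 2 ∂P + 1 := by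
  have hexp (ω : Ω) : ‖∑ i ∈ Finset.range (n + 1 + 1), e i ω‖ ^ 2 =
      ‖∑ i ∈ Finset.range (n + 1), e i ω‖ ^ 2 + 1 +
        2 * (conj (∑ i ∈ Finset.range (n + 1), e i ω) * e (n + 1) ω).re := by
    rw [Finset.sum_range_succ _ (n + 1), add_comm, ← Complex.normSq_eq_norm_sq,
      Complex.normSq_add, Complex.normSq_eq_norm_sq, Complex.normSq_eq_norm_sq,
      h.norm_eq_one, mul_comm (e (n + 1) ω)]
    ring
  have hZm : StronglyMeasurable[𝒢 n] fun ω => conj (∑ i ∈ Finset.range (n + 1), e i ω) :=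
    Complex.continuous_conj.comp_stronglyMeasurable (h.stronglyMeasurable_sum n)
  have hZb (ω : Ω) : ‖conj (∑ i ∈ Finset.range (n + 1), e i ω)‖ ≤ (n : ℝ) + 1 := by
    rw [RCLike.norm_conj]; exact h.norm_sum_le n ω
  have hint : Integrable
      (fun ω => conj (∑ i ∈ Finset.range (n + 1), e i ω) * e (n + 1) ω) P := by
    refine Integrable.of_bound ((hZm.mono (𝒢.le n)).mul
      ((h.stronglyMeasurable (n + 1)).mono (𝒢.le _))).aestronglyMeasurable ((n : ℝ) + 1)
      (.of_forall fun ω => ?_)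
    rw [norm_mul, h.norm_eq_one, mul_one]
    exact hZb ω
  have h1 := h.integral_mul_succ n _ _ hZm hZb
  have h2 (ω : Ω) : conj (∑ i ∈ Finset.range (n + 1), e i ω) *
      ∑ i ∈ Finset.range (n + 1), e i ω =
      ((‖∑ i ∈ Finset.range (n + 1), e i ω‖ ^ 2 : ℝ) : ℂ) := by
    rw [← Complex.normSq_eq_conj_mul_self, Complex.normSq_eq_norm_sq]
  simp_rw [h2] at h1
  rw [integral_complex_ofReal] at h1
  have hre := integral_re hint
  have hint' := hint.re
  simp only [RCLike.re_to_complex] at hre hint'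
  have hint1 : Integrable (fun ω => ‖∑ i ∈ Finset.range (n + 1), e i ω‖ ^ 2 + 1) P :=
    (h.integrable_norm_sum_sq n).add (integrable_const _)
  simp_rw [hexp]
  rw [integral_add hint1 (hint'.const_mul 2),
    integral_add (h.integrable_norm_sum_sq n) (integrable_const _), integral_const_mul, hre, h1,
    Complex.re_mul_ofReal, ← Nat.cast_add_one, Complex.div_natCast_re]
  simp
  ring

lemma le_integral_norm_sum_sq (h : IsUrnSequence P 𝒢 φ e) (n : ℕ) :
    (‖urnFactor φ n‖ * ‖φ‖) ^ 2 ≤ ∫ ω, ‖∑ i ∈ Finset.range (n + 1), e i ω‖ ^ 2 ∂P := by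
  have hm := ((h.stronglyMeasurable_sum n).mono (𝒢.le n)).norm
  have hmem : MemLp (fun ω => ‖∑ i ∈ Finset.range (n + 1), e i ω‖) 2 P :=
    MemLp.of_bound hm.aestronglyMeasurable ((n : ℝ) + 1) (.of_forall fun ω => by
      rw [norm_norm]; exact h.norm_sum_le n ω)
  have hvar := variance_nonneg (fun ω => ‖∑ i ∈ Finset.range (n + 1), e i ω‖) P
  rw [variance_eq_sub hmem] at hvar
  simp only [Pi.pow_apply] at hvar
  rw [← norm_mul, ← h.integral_sum n]
  have h1 := pow_le_pow_left₀ (norm_nonneg _)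
    (norm_integral_le_integral_norm (μ := P) fun ω => ∑ i ∈ Finset.range (n + 1), e i ω) 2
  linarith

lemma summable_add_one_rpow : Summable fun j : ℕ => ((j : ℝ) + 1) ^ (-(5 / 4) : ℝ) := by
  have := (summable_nat_add_iff 1).2
    (Real.summable_nat_rpow (p := -(5 / 4)).2 (by norm_num))
  simpa using this

/-- The factor `‖1 - φ‖` is essential: a mere `L²` bound would not give closeness to `1`. It appears
because the source term of the recursion, `1 - A‖φ‖²/(n+1)²`, is at most of order `‖1 - φ‖ log n`,
by the Jensen lower bound on the second moment `A`. -/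
lemma integral_norm_sum_sq_le (h : IsUrnSequence P 𝒢 φ e) (hφ : ‖1 - φ‖ ≤ 1 / 4) (n : ℕ) :
    ∫ ω, ‖∑ i ∈ Finset.range (n + 1), e i ω‖ ^ 2 ∂P ≤ ‖urnFactor φ n‖ ^ 2 *
      (1 + 12 * ‖1 - φ‖ * ∑ j ∈ Finset.range n, ((j : ℝ) + 1) ^ (-(5 / 4) : ℝ)) := by
  induction n with
  | zero => simp [h.norm_eq_one, urnFactor]
  | succ n ih =>
    rw [h.integral_norm_sum_sq_succ n, Finset.sum_range_succ]
    have hlow := h.le_integral_norm_sum_sq n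
    have hφ1 := h.norm_factor_le_one
    set A := ∫ ω, ‖∑ i ∈ Finset.range (n + 1), e i ω‖ ^ 2 ∂P
    set T := ∑ j ∈ Finset.range n, ((j : ℝ) + 1) ^ (-(5 / 4) : ℝ)
    set δ := ‖1 - φ‖ with hδ
    have hδ0 : 0 ≤ δ := norm_nonneg _
    have hn : (0 : ℝ) < (n : ℝ) + 1 := by positivity
    have hq : ‖urnFactor φ (n + 1)‖ ^ 2 = ‖urnFactor φ n‖ ^ 2 *
        (1 + 2 * φ.re / ((n : ℝ) + 1) + ‖φ‖ ^ 2 / ((n : ℝ) + 1) ^ 2) := by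
      rw [urnFactor_succ, norm_mul, mul_pow]
      congr 1
      rw [← Complex.normSq_eq_norm_sq, Complex.normSq_add, ← Nat.cast_add_one, map_div₀,
        Complex.normSq_natCast, map_one, Complex.normSq_eq_norm_sq]
      simp only [map_div₀, map_natCast, one_mul, Complex.div_natCast_re,
        Complex.conj_re]
      push_cast
      ring
    have hlog : Real.log ((n : ℝ) + 1) ≤ 4 * ((n : ℝ) + 1) ^ (1 / 4 : ℝ) := by
      have := Real.log_le_rpow_div hn.le (show (0 : ℝ) < 1 / 4 by norm_num)
      linarith
    have hone : (1 : ℝ) ≤ ((n : ℝ) + 1) ^ (1 / 4 : ℝ) :=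
      Real.one_le_rpow (by linarith [(n.cast_nonneg : (0 : ℝ) ≤ n)]) (by norm_num)
    -- the deficit of the second moment is controlled by the harmonic sum
    have hdef : 1 - A * ‖φ‖ ^ 2 / ((n : ℝ) + 1) ^ 2 ≤
        12 * δ * ((n : ℝ) + 1) ^ (1 / 4 : ℝ) := by
      have hp := one_sub_norm_mul_sum_le (1 - φ) (by linarith) n
      set S := ∑ j ∈ Finset.range n, 1 / ((j : ℝ) + 2) with hS
      have hSle : S ≤ Real.log ((n : ℝ) + 1) := sum_one_div_add_two_le n
      have hS0 : 0 ≤ S := Finset.sum_nonneg fun j _ => by positivity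
      have hfac : ‖urnFactor φ n‖ = ((n : ℝ) + 1) *
          ‖∏ j ∈ Finset.range n, (1 - (1 - φ) / ((j : ℂ) + 2))‖ := by
        rw [urnFactor_eq, norm_mul, ← Nat.cast_add_one, Complex.norm_natCast]
        push_cast; rfl
      set p := ‖∏ j ∈ Finset.range n, (1 - (1 - φ) / ((j : ℂ) + 2))‖
      have hp0 : 0 ≤ p := norm_nonneg _
      have hφlow : 1 - δ ≤ ‖φ‖ := by
        have := norm_sub_norm_le (1 : ℂ) (1 - φ)
        rw [norm_one, sub_sub_cancel] at this
        exact this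
      have hy : 1 - 2 * δ - δ * S ≤ ‖φ‖ ^ 2 * p := by
        have h2 : 1 - 2 * δ ≤ ‖φ‖ ^ 2 := by nlinarith
        by_cases hc : 1 - δ * S ≤ 0
        · have : 0 ≤ ‖φ‖ ^ 2 * p := by positivity
          linarith
        · push Not at hc
          calc 1 - 2 * δ - δ * S ≤ (1 - 2 * δ) * (1 - δ * S) := by
                nlinarith [mul_nonneg hδ0 (mul_nonneg hδ0 hS0)]
            _ ≤ ‖φ‖ ^ 2 * p := by gcongr
      have hA : (‖φ‖ ^ 2 * p) ^ 2 ≤ A * ‖φ‖ ^ 2 / ((n : ℝ) + 1) ^ 2 := by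
        rw [le_div_iff₀ (by positivity)]
        calc (‖φ‖ ^ 2 * p) ^ 2 * ((n : ℝ) + 1) ^ 2
            = (‖urnFactor φ n‖ * ‖φ‖) ^ 2 * ‖φ‖ ^ 2 := by rw [hfac]; ring
          _ ≤ A * ‖φ‖ ^ 2 := by gcongr
      -- With `y = ‖φ‖² p`, use `1 - y² ≤ 2 (1 - y) ≤ 2 δ (2 + S)`. The bounds on `2` and on the
      -- logarithm by the power `1/4` add up to the factor `6`, whence `12`.
      nlinarith [sq_nonneg (1 - ‖φ‖ ^ 2 * p), mul_le_mul_of_nonneg_left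
        (show 2 + S ≤ 6 * ((n : ℝ) + 1) ^ (1 / 4 : ℝ) by linarith) hδ0]
    have ha : ((n : ℝ) + 1) ^ (3 / 2 : ℝ) ≤ ‖urnFactor φ (n + 1)‖ ^ 2 := by
      have h1 := rpow_le_norm_urnFactor hφ (n + 1)
      calc ((n : ℝ) + 1) ^ (3 / 2 : ℝ) ≤ (((n + 1 : ℕ) : ℝ) + 1) ^ (3 / 2 : ℝ) := by
            gcongr; linarith
        _ = ((((n + 1 : ℕ) : ℝ) + 1) ^ (3 / 4 : ℝ)) ^ 2 := by
            rw [← Real.rpow_natCast, ← Real.rpow_mul (by positivity)]; norm_num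
        _ ≤ _ := by gcongr
    -- The summable exponent is `-5/4 = 1/4 - 3/2`: logarithmic loss against squared growth.
    have hstep : 12 * δ * ((n : ℝ) + 1) ^ (1 / 4 : ℝ) ≤ ‖urnFactor φ (n + 1)‖ ^ 2 *
        (12 * δ * ((n : ℝ) + 1) ^ (-(5 / 4) : ℝ)) := by
      calc _ = ((n : ℝ) + 1) ^ (3 / 2 : ℝ) * (12 * δ * ((n : ℝ) + 1) ^ (-(5 / 4) : ℝ)) := by
            rw [mul_left_comm, ← Real.rpow_add hn]; norm_num
        _ ≤ _ := by gcongr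
    have hqn : 0 ≤ 1 + 2 * φ.re / ((n : ℝ) + 1) + ‖φ‖ ^ 2 / ((n : ℝ) + 1) ^ 2 := by
      have h0 : 0 < ‖urnFactor φ n‖ ^ 2 := by
        have := rpow_le_norm_urnFactor hφ n
        have h2 : 0 < ((n : ℝ) + 1) ^ (3 / 4 : ℝ) := by positivity
        have h3 := h2.trans_le this
        positivity
      have := sq_nonneg ‖urnFactor φ (n + 1)‖
      rw [hq] at this
      exact nonneg_of_mul_nonneg_right this h0
    set q := 1 + 2 * φ.re / ((n : ℝ) + 1) + ‖φ‖ ^ 2 / ((n : ℝ) + 1) ^ 2 with hqdef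
    have hmul := mul_le_mul_of_nonneg_right ih hqn
    calc (1 + 2 * φ.re / ((n : ℝ) + 1)) * A + 1
        = A * q + (1 - A * ‖φ‖ ^ 2 / ((n : ℝ) + 1) ^ 2) := by rw [hqdef]; ring
      _ ≤ ‖urnFactor φ n‖ ^ 2 * (1 + 12 * δ * T) * q + ‖urnFactor φ (n + 1)‖ ^ 2 *
          (12 * δ * ((n : ℝ) + 1) ^ (-(5 / 4) : ℝ)) := by linarith
      _ = _ := by rw [hq]; ring

lemma urnFactor_ne_zero (hφ : ‖1 - φ‖ ≤ 1 / 4) (n : ℕ) : urnFactor φ n ≠ 0 := by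
  have h1 := rpow_le_norm_urnFactor hφ n
  have h2 : 0 < ((n : ℝ) + 1) ^ (3 / 4 : ℝ) := by positivity
  exact norm_pos_iff.1 (h2.trans_le h1)

/-- The normalized urn sum stays close to `1` in mean square. -/
lemma integral_norm_div_sub_one_sq_le (h : IsUrnSequence P 𝒢 φ e) (hφ : ‖1 - φ‖ ≤ 1 / 4) (n : ℕ) :
    ∫ ω, ‖(∑ i ∈ Finset.range (n + 1), e i ω) / urnFactor φ n - 1‖ ^ 2 ∂P ≤
      (12 * (∑' j : ℕ, ((j : ℝ) + 1) ^ (-(5 / 4) : ℝ)) + 2) * ‖1 - φ‖ := by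
  have ha := urnFactor_ne_zero hφ n
  have hexp (ω : Ω) : ‖(∑ i ∈ Finset.range (n + 1), e i ω) / urnFactor φ n - 1‖ ^ 2 =
      (‖urnFactor φ n‖ ^ 2)⁻¹ * ‖∑ i ∈ Finset.range (n + 1), e i ω‖ ^ 2 + 1 -
        2 * ((urnFactor φ n)⁻¹ * ∑ i ∈ Finset.range (n + 1), e i ω).re := by
    rw [← Complex.normSq_eq_norm_sq, Complex.normSq_sub, map_div₀, Complex.normSq_eq_norm_sq,
      Complex.normSq_eq_norm_sq, div_eq_inv_mul, div_eq_inv_mul]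
    simp
  have hint : Integrable (fun ω => ∑ i ∈ Finset.range (n + 1), e i ω) P :=
    Integrable.of_bound ((h.stronglyMeasurable_sum n).mono (𝒢.le n)).aestronglyMeasurable _
        (.of_forall fun ω => h.norm_sum_le n ω)
  have hint1 := hint.const_mul (urnFactor φ n)⁻¹
  have hre := integral_re hint1
  have hint' := hint1.re
  simp only [RCLike.re_to_complex] at hre hint'
  have hint2 : Integrable (fun ω => (‖urnFactor φ n‖ ^ 2)⁻¹ *
      ‖∑ i ∈ Finset.range (n + 1), e i ω‖ ^ 2 + 1) P :=
    ((h.integrable_norm_sum_sq n).const_mul _).add (integrable_const _)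
  simp_rw [hexp]
  rw [integral_sub hint2 (hint'.const_mul 2), integral_add ((h.integrable_norm_sum_sq n).const_mul _)
    (integrable_const _), integral_const_mul, integral_const_mul, hre, integral_const_mul,
    h.integral_sum n, inv_mul_cancel_left₀ ha]
  have h0 : 0 < ‖urnFactor φ n‖ ^ 2 := by positivity
  have h1 : (‖urnFactor φ n‖ ^ 2)⁻¹ * ∫ ω, ‖∑ i ∈ Finset.range (n + 1), e i ω‖ ^ 2 ∂P ≤
      1 + 12 * ‖1 - φ‖ * ∑' j : ℕ, ((j : ℝ) + 1) ^ (-(5 / 4) : ℝ) := by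
    rw [inv_mul_le_iff₀ h0]
    refine (h.integral_norm_sum_sq_le hφ n).trans ?_
    gcongr
    exact summable_add_one_rpow.sum_le_tsum _ fun j _ => by positivity
  have h2 : 1 - φ.re ≤ ‖1 - φ‖ := by simpa using Complex.re_le_norm (1 - φ)
  simp only [integral_const, probReal_univ, smul_eq_mul, mul_one]
  nlinarith

/-- The squared modulus of a martingale minus a constant: the cross term with the increment `D`
integrates to zero over past events, and `‖D‖²` is nonnegative. -/
lemma submartingale_norm_div_sub_one_sq (h : IsUrnSequence P 𝒢 φ e) (hφ : ‖1 - φ‖ ≤ 1 / 4) :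
    Submartingale (fun n ω => ‖(∑ i ∈ Finset.range (n + 1), e i ω) / urnFactor φ n - 1‖ ^ 2)
      𝒢 P := by
  have hW (n : ℕ) : StronglyMeasurable[𝒢 n]
      fun ω => (∑ i ∈ Finset.range (n + 1), e i ω) / urnFactor φ n - 1 := by
    simp_rw [div_eq_mul_inv]
    exact ((h.stronglyMeasurable_sum n).mul_const _).sub stronglyMeasurable_const
  have hWb (n : ℕ) : ∃ C : ℝ, ∀ ω,
      ‖(∑ i ∈ Finset.range (n + 1), e i ω) / urnFactor φ n - 1‖ ≤ C := by
    refine ⟨((n : ℝ) + 1) / ‖urnFactor φ n‖ + 1, fun ω => (norm_sub_le _ _).trans ?_⟩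
    rw [norm_div, norm_one]
    gcongr
    exact h.norm_sum_le n ω
  have hf (n : ℕ) : Integrable
      (fun ω => ‖(∑ i ∈ Finset.range (n + 1), e i ω) / urnFactor φ n - 1‖ ^ 2) P := by
    obtain ⟨C, hC⟩ := hWb n
    refine Integrable.of_bound (((hW n).mono (𝒢.le n)).norm.pow 2).aestronglyMeasurable (C ^ 2)
      (.of_forall fun ω => ?_)
    rw [norm_pow, norm_norm]
    gcongr
    exact hC ω
  refine submartingale_of_setIntegral_le_succ (fun n => (hW n).norm.pow 2) hf fun n s hs => ?_
  have ha := urnFactor_ne_zero hφ n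
  have ha' := urnFactor_ne_zero hφ (n + 1)
  have hb : 1 + φ / ((n : ℂ) + 1) ≠ 0 := by
    rw [urnFactor_succ] at ha'
    exact right_ne_zero_of_mul ha'
  have hn1 : (n : ℂ) + 1 ≠ 0 := by exact_mod_cast n.succ_ne_zero
  have hb' : (n : ℂ) + 1 + φ ≠ 0 := fun h0 => hb (by
    field_simp
    rw [mul_zero, h0])
  obtain ⟨C, hC⟩ := hWb n
  set Z : Ω → ℂ := s.indicator fun ω =>
    conj ((∑ i ∈ Finset.range (n + 1), e i ω) / urnFactor φ n - 1) with hZ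
  have hZm : StronglyMeasurable[𝒢 n] Z :=
    (Complex.continuous_conj.comp_stronglyMeasurable (hW n)).indicator hs
  have hZb (ω : Ω) : ‖Z ω‖ ≤ C := by
    refine (norm_indicator_le_norm_self _ _).trans ?_
    rw [RCLike.norm_conj]
    exact hC ω
  have hZm' := (hZm.mono (𝒢.le n)).aestronglyMeasurable (μ := P)
  have hem := ((h.stronglyMeasurable (n + 1)).mono (𝒢.le _)).aestronglyMeasurable (μ := P)
  have hSm := ((h.stronglyMeasurable_sum n).mono (𝒢.le n)).aestronglyMeasurable (μ := P)
  have hi1 : Integrable (fun ω => Z ω * e (n + 1) ω) P :=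
    Integrable.of_bound (hZm'.mul hem) C (.of_forall fun ω => by
      rw [norm_mul, h.norm_eq_one, mul_one]; exact hZb ω)
  have hi2 : Integrable (fun ω => Z ω * ∑ i ∈ Finset.range (n + 1), e i ω) P :=
    Integrable.of_bound (hZm'.mul hSm) (C * ((n : ℝ) + 1)) (.of_forall fun ω => by
      rw [norm_mul]
      have := (norm_nonneg _).trans (hZb ω)
      gcongr
      exacts [hZb ω, h.norm_sum_le n ω])
  have hincr (ω : Ω) : (∑ i ∈ Finset.range (n + 1 + 1), e i ω) / urnFactor φ (n + 1) =
      (∑ i ∈ Finset.range (n + 1), e i ω) / urnFactor φ n + (urnFactor φ (n + 1))⁻¹ *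
      (e (n + 1) ω - φ / ((n : ℂ) + 1) * ∑ i ∈ Finset.range (n + 1), e i ω) := by
    rw [Finset.sum_range_succ _ (n + 1), urnFactor_succ]
    field_simp
    ring
  set D : Ω → ℂ := fun ω => (urnFactor φ (n + 1))⁻¹ *
      (e (n + 1) ω - φ / ((n : ℂ) + 1) * ∑ i ∈ Finset.range (n + 1), e i ω) with hD
  have hZD : (fun ω => Z ω * D ω) = fun ω => (urnFactor φ (n + 1))⁻¹ * (Z ω * e (n + 1) ω -
      φ / ((n : ℂ) + 1) * (Z ω * ∑ i ∈ Finset.range (n + 1), e i ω)) := by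
    ext ω
    simp only [hD]
    ring
  have hZDi : Integrable (fun ω => Z ω * D ω) P := by
    rw [hZD]
    exact (hi1.sub (hi2.const_mul _)).const_mul _
  have hzero : ∫ ω, Z ω * D ω ∂P = 0 := by
    rw [hZD, integral_const_mul, integral_sub hi1 (hi2.const_mul _), integral_const_mul,
      h.integral_mul_succ n Z C hZm hZb, sub_self, mul_zero]
  have hre := integral_re hZDi
  have hZDi' := hZDi.re
  simp only [RCLike.re_to_complex] at hre hZDi'
  have hs' := 𝒢.le n s hs
  rw [← integral_indicator hs', ← integral_indicator hs']
  -- The cross term is added for free, so that the inequality becomes pointwise.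
  have hsum : ∫ ω, s.indicator
        (fun ω => ‖(∑ i ∈ Finset.range (n + 1), e i ω) / urnFactor φ n - 1‖ ^ 2) ω ∂P =
      ∫ ω, (s.indicator
        (fun ω => ‖(∑ i ∈ Finset.range (n + 1), e i ω) / urnFactor φ n - 1‖ ^ 2) ω +
        2 * (Z ω * D ω).re) ∂P := by
    rw [integral_add ((hf n).indicator hs') (hZDi'.const_mul 2), integral_const_mul, hre, hzero]
    simp
  rw [hsum]
  refine integral_mono (((hf n).indicator hs').add (hZDi'.const_mul 2))
    ((hf (n + 1)).indicator hs') fun ω => ?_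
  by_cases hω : ω ∈ s
  · simp only [Set.indicator_of_mem hω, hZ, hincr]
    set w := (∑ i ∈ Finset.range (n + 1), e i ω) / urnFactor φ n
    change ‖w - 1‖ ^ 2 + 2 * (conj (w - 1) * D ω).re ≤ ‖w + D ω - 1‖ ^ 2
    rw [show w + D ω - 1 = D ω + (w - 1) by ring, ← Complex.normSq_eq_norm_sq (D ω + (w - 1)),
      Complex.normSq_add, Complex.normSq_eq_norm_sq, Complex.normSq_eq_norm_sq,
      mul_comm (D ω) (conj _)]
    linarith [sq_nonneg ‖D ω‖]
  · simp [Set.indicator_of_notMem hω, hZ]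

/-- Maximal inequality for the normalized urn sums. -/
lemma measure_exists_le_norm_div_sub_one_sq (h : IsUrnSequence P 𝒢 φ e) (hφ : ‖1 - φ‖ ≤ 1 / 4)
    {ε : ℝ} (hε : 0 < ε) (N : ℕ) :
    P {ω | ∃ n ≤ N, ε ≤ ‖(∑ i ∈ Finset.range (n + 1), e i ω) / urnFactor φ n - 1‖ ^ 2} ≤
      ENNReal.ofReal ((12 * (∑' j : ℕ, ((j : ℝ) + 1) ^ (-(5 / 4) : ℝ)) + 2) * ‖1 - φ‖ / ε) := by
  have hsub := h.submartingale_norm_div_sub_one_sq hφ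
  have hmax := maximal_ineq hsub (fun n ω => by positivity) (ε := ⟨ε, hε.le⟩) N
  have hset : {ω | ∃ n ≤ N, ε ≤ ‖(∑ i ∈ Finset.range (n + 1), e i ω) / urnFactor φ n - 1‖ ^ 2} =
      {ω | (((⟨ε, hε.le⟩ : NNReal)) : ℝ) ≤ (Finset.range (N + 1)).sup' Finset.nonempty_range_add_one
        fun n => ‖(∑ i ∈ Finset.range (n + 1), e i ω) / urnFactor φ n - 1‖ ^ 2} := by
    ext ω
    simp [Finset.le_sup'_iff]
  rw [hset]
  have hle := hmax.trans (ENNReal.ofReal_le_ofReal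
    ((setIntegral_le_integral (hsub.integrable N) (.of_forall fun ω => by positivity)).trans
      (h.integral_norm_div_sub_one_sq_le hφ N)))
  rw [ENNReal.ofReal_div_of_pos hε]
  rw [ENNReal.le_div_iff_mul_le (by simp [hε]) (by simp), mul_comm]
  rw [ENNReal.ofReal_eq_coe_nnreal hε.le]
  exact hle

end IsUrnSequence

end Martingale

/-! ### Independence of two merged families. -/

section Independence

variable {Ω : Type*} {mΩ : MeasurableSpace Ω} {P : Measure Ω}

/-- With displacements and choices in one family, past and novelty become disjoint index sets. -/
lemma iIndep_sumElim {ι κ : Type*} {m₁ : ι → MeasurableSpace Ω} {m₂ : κ → MeasurableSpace Ω}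
    (h₁ : iIndep m₁ P) (h₂ : iIndep m₂ P) (h : Indep (⨆ i, m₁ i) (⨆ i, m₂ i) P) :
    iIndep (Sum.elim m₁ m₂) P := by
  rw [iIndep_iff]
  intro s f hf
  have hl (i : ι) (hi : i ∈ s.toLeft) : MeasurableSet[m₁ i] (f (Sum.inl i)) :=
    hf _ (Finset.mem_toLeft.1 hi)
  have hr (i : κ) (hi : i ∈ s.toRight) : MeasurableSet[m₂ i] (f (Sum.inr i)) :=
    hf _ (Finset.mem_toRight.1 hi)
  have hinter : ⋂ i ∈ s, f i =
      (⋂ i ∈ s.toLeft, f (Sum.inl i)) ∩ ⋂ i ∈ s.toRight, f (Sum.inr i) := by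
    ext ω
    simp
  have hprod : ∏ i ∈ s, P (f i) =
      (∏ i ∈ s.toLeft, P (f (Sum.inl i))) * ∏ i ∈ s.toRight, P (f (Sum.inr i)) := by
    conv_lhs => rw [← Finset.toLeft_disjSum_toRight (u := s)]
    rw [Finset.prod_disjSum]
  rw [hinter, hprod, ← h₁.meas_biInter hl, ← h₂.meas_biInter hr]
  refine (Indep_iff _ _ _).1 h _ _ ?_ ?_
  · exact Finset.measurableSet_biInter _ fun i hi => le_iSup m₁ i _ (hl i hi)
  · exact Finset.measurableSet_biInter _ fun i hi => le_iSup m₂ i _ (hr i hi)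

lemma integral_mul_of_indep {m₁ m₂ : MeasurableSpace Ω} (hm₁ : m₁ ≤ mΩ) (hm₂ : m₂ ≤ mΩ)
    (h : Indep m₁ m₂ P) {X Y : Ω → ℂ} (hX : StronglyMeasurable[m₁] X)
    (hY : StronglyMeasurable[m₂] Y) : ∫ ω, X ω * Y ω ∂P = (∫ ω, X ω ∂P) * ∫ ω, Y ω ∂P := by
  have hXY : IndepFun X Y P := by
    rw [IndepFun_iff_Indep]
    exact indep_of_indep_of_le_left (indep_of_indep_of_le_right h hY.measurable.comap_le)
      hX.measurable.comap_le
  exact hXY.integral_fun_mul_eq_mul_integral (hX.mono hm₁).aestronglyMeasurable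
    (hY.mono hm₂).aestronglyMeasurable

end Independence

/-! ### The exponentials of the colours form an urn sequence. -/

section Urn

lemma urnColour_zero {E : Type*} [Add E] (δ : ℕ → E) (u : (n : ℕ) → Fin (n + 1)) :
    urnColour δ u 0 = δ 0 := by
  rw [urnColour]

lemma urnColour_succ {E : Type*} [Add E] (δ : ℕ → E) (u : (n : ℕ) → Fin (n + 1)) (n : ℕ) :
    urnColour δ u (n + 1) = urnColour δ u (u n) + δ (n + 1) := by
  rw [urnColour]

lemma measurable_fin_apply {E Ω : Type*} [MeasurableSpace E] [MeasurableSpace Ω] {k : ℕ}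
    {f : Fin k → Ω → E} (hf : ∀ i, Measurable (f i)) {u : Ω → Fin k} (hu : Measurable u) :
    Measurable fun ω => f (u ω) ω :=
  (measurable_from_prod_countable_right (f := fun p : Fin k × Ω => f p.1 p.2) hf).comp
    (hu.prodMk measurable_id)

section Sigma

variable {E Ω : Type*} [MeasurableSpace E] {mΩ : MeasurableSpace Ω} {P : Measure Ω}

/-- The σ-algebras generated by the displacements and by the choices. -/
@[reducible] def urnSigma (Δ : ℕ → Ω → E) (U : (n : ℕ) → Ω → Fin (n + 1)) : ℕ ⊕ ℕ → MeasurableSpace Ω :=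
  Sum.elim (fun i => MeasurableSpace.comap (Δ i) inferInstance)
    (fun i => MeasurableSpace.comap (U i) inferInstance)

lemma urnSigma_le {Δ : ℕ → Ω → E} {U : (n : ℕ) → Ω → Fin (n + 1)} (hΔ : ∀ i, Measurable (Δ i))
    (hU : ∀ n, Measurable (U n)) (i : ℕ ⊕ ℕ) : urnSigma Δ U i ≤ mΩ := by
  cases i with
  | inl i => exact (hΔ i).comap_le
  | inr i => exact (hU i).comap_le

lemma iIndep_urnSigma {Δ : ℕ → Ω → E} {U : (n : ℕ) → Ω → Fin (n + 1)}
    (hΔ_indep : iIndepFun Δ P) (hU_indep : iIndepFun U P)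
    (hΔU : IndepFun (fun ω i => Δ i ω) (fun ω n => U n ω) P) : iIndep (urnSigma Δ U) P := by
  refine iIndep_sumElim hΔ_indep.iIndep hU_indep.iIndep ?_
  rw [IndepFun_iff_Indep] at hΔU
  convert hΔU using 1
  · simp only [MeasurableSpace.pi, MeasurableSpace.comap_iSup, MeasurableSpace.comap_comp]
    rfl
  · simp only [MeasurableSpace.pi, MeasurableSpace.comap_iSup, MeasurableSpace.comap_comp]
    rfl

end Sigma

variable {E : Type*} [NormedAddCommGroup E] [InnerProductSpace ℝ E] [MeasurableSpace E]
  [BorelSpace E] [FiniteDimensional ℝ E]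

open scoped RealInnerProductSpace

lemma measurable_urnColour {Ω : Type*} [MeasurableSpace Ω] {Δ : ℕ → Ω → E}
    {U : (n : ℕ) → Ω → Fin (n + 1)} {N : ℕ} (hΔ : ∀ i ≤ N, Measurable (Δ i))
    (hU : ∀ i < N, Measurable (U i)) {n : ℕ} (hn : n ≤ N) :
    Measurable fun ω => urnColour (fun i => Δ i ω) (fun k => U k ω) n := by
  induction n using Nat.strong_induction_on with
  | _ n ih =>
    cases n with
    | zero =>
      simp_rw [urnColour_zero]
      exact hΔ 0 hn
    | succ n =>
      simp_rw [urnColour_succ]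
      exact (measurable_fin_apply
        (f := fun (i : Fin (n + 1)) ω => urnColour (fun i => Δ i ω) (fun k => U k ω) i)
        (fun i => ih i i.isLt (by lia)) (hU n hn)).add (hΔ _ hn)

variable {Ω : Type*} {mΩ : MeasurableSpace Ω}

/-- The natural filtration of the urn. -/
def urnFiltration {Δ : ℕ → Ω → E} {U : (n : ℕ) → Ω → Fin (n + 1)} (hΔ : ∀ i, Measurable (Δ i))
    (hU : ∀ n, Measurable (U n)) : Filtration ℕ mΩ where
  -- The inequality on choices is strict because `U n` selects the parent of ball `n + 1`.
  seq n := ⨆ i ∈ {x : ℕ ⊕ ℕ | Sum.elim (· ≤ n) (· < n) x}, urnSigma Δ U i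
  mono' m n hmn := by
    refine biSup_mono fun i hi => ?_
    cases i with
    | inl i => exact le_trans (show i ≤ m from hi) hmn
    | inr i => exact lt_of_lt_of_le (show i < m from hi) hmn
  le' n := iSup₂_le fun i _ => urnSigma_le hΔ hU i

lemma stronglyMeasurable_exp_urnColour {Δ : ℕ → Ω → E} {U : (n : ℕ) → Ω → Fin (n + 1)}
    (hΔ : ∀ i, Measurable (Δ i)) (hU : ∀ n, Measurable (U n)) (t : E) (n : ℕ) :
    StronglyMeasurable[urnFiltration hΔ hU n] fun ω =>
      Complex.exp (⟪urnColour (fun i => Δ i ω) (fun k => U k ω) n, t⟫ * Complex.I) := by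
  have hX : Measurable[urnFiltration hΔ hU n]
      fun ω => urnColour (fun i => Δ i ω) (fun k => U k ω) n := by
    refine @measurable_urnColour E _ _ _ _ _ Ω (urnFiltration hΔ hU n) Δ U n ?_ ?_ n le_rfl
    · intro i hi
      rw [measurable_iff_comap_le]
      exact le_iSup₂_of_le (f := fun (i : ℕ ⊕ ℕ)
        (_ : i ∈ {x : ℕ ⊕ ℕ | Sum.elim (· ≤ n) (· < n) x}) => urnSigma Δ U i) (Sum.inl i) hi le_rfl
    · intro i hi
      rw [measurable_iff_comap_le]
      exact le_iSup₂_of_le (f := fun (i : ℕ ⊕ ℕ)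
        (_ : i ∈ {x : ℕ ⊕ ℕ | Sum.elim (· ≤ n) (· < n) x}) => urnSigma Δ U i) (Sum.inr i) hi le_rfl
  have hg : Measurable fun x : E => Complex.exp (⟪x, t⟫ * Complex.I) := by fun_prop
  exact (hg.comp hX).stronglyMeasurable

variable {P : Measure Ω} [IsProbabilityMeasure P]

/-- Splitting over the value of `U n` writes each term as a past factor, an indicator of mean
`1/(n+1)` and an exponential of the new displacement, of mean `φ`; independence factorizes the
integral. -/
lemma isUrnSequence_exp_urnColour {Δ : ℕ → Ω → E} {U : (n : ℕ) → Ω → Fin (n + 1)}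
    (hΔ : ∀ i, Measurable (Δ i)) (hU : ∀ n, Measurable (U n))
    (hΔ_indep : iIndepFun Δ P) (hΔ_ident : ∀ i, IdentDistrib (Δ i) (Δ 0) P P)
    (hU_indep : iIndepFun U P)
    (hU_unif : ∀ n, P.map (U n) = (PMF.uniformOfFintype (Fin (n + 1))).toMeasure)
    (hΔU : IndepFun (fun ω i => Δ i ω) (fun ω n => U n ω) P) (t : E) :
    IsUrnSequence P (urnFiltration hΔ hU) (charFun (P.map (Δ 0)) t) fun n ω =>
      Complex.exp (⟪urnColour (fun i => Δ i ω) (fun k => U k ω) n, t⟫ * Complex.I) where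
  stronglyMeasurable n := stronglyMeasurable_exp_urnColour hΔ hU t n
  norm_eq_one n ω := Complex.norm_exp_ofReal_mul_I _
  integral_zero := by
    simp_rw [urnColour_zero]
    rw [charFun_apply, integral_map (hΔ 0).aemeasurable (by fun_prop)]
  integral_mul_succ n Z C hZ hZb := by
    set e : ℕ → Ω → ℂ := fun n ω =>
      Complex.exp (⟪urnColour (fun i => Δ i ω) (fun k => U k ω) n, t⟫ * Complex.I) with he
    set ψ : Ω → ℂ := fun ω => Complex.exp (⟪Δ (n + 1) ω, t⟫ * Complex.I) with hψ
    let V : Fin (n + 1) → Ω → ℂ := fun i => (U n ⁻¹' {i}).indicator 1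
    have hem (i : Fin (n + 1)) : StronglyMeasurable[urnFiltration hΔ hU n] (e i) :=
      (stronglyMeasurable_exp_urnColour hΔ hU t i).mono
        ((urnFiltration hΔ hU).mono (Nat.lt_succ_iff.1 i.isLt))
    have hsplit (ω : Ω) : Z ω * e (n + 1) ω =
        ∑ i : Fin (n + 1), Z ω * e i ω * V i ω * ψ ω := by
      rw [Finset.sum_eq_single (U n ω)]
      · simp only [he, hψ, V, urnColour_succ, inner_add_left, Complex.ofReal_add, add_mul,
          Complex.exp_add]
        simp
        ring
      · intro i _ hi
        have : V i ω = 0 := Set.indicator_of_notMem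
          (s := U n ⁻¹' {i}) (fun h => hi (Eq.symm h)) _
        simp [this]
      · simp
    have hle := urnSigma_le hΔ hU
    have hind := iIndep_urnSigma hΔ_indep hU_indep hΔU
    -- the new displacement is independent of the past and of the new choice
    have hI1 : Indep (urnFiltration hΔ hU n ⊔ urnSigma Δ U (Sum.inr n))
        (urnSigma Δ U (Sum.inl (n + 1))) P := by
      have h1 := indep_iSup_of_disjoint hle hind
        (S := {x : ℕ ⊕ ℕ | Sum.elim (· ≤ n) (· ≤ n) x}) (T := {Sum.inl (n + 1)}) (by simp)
      rw [iSup_singleton] at h1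
      refine indep_of_indep_of_le_left h1 (sup_le (iSup₂_le fun i hi => ?_) ?_)
      · refine le_iSup₂_of_le (f := fun (i : ℕ ⊕ ℕ)
          (_ : i ∈ {x : ℕ ⊕ ℕ | Sum.elim (· ≤ n) (· ≤ n) x}) => urnSigma Δ U i) i ?_ le_rfl
        cases i with
        | inl i => exact hi
        | inr i => exact le_of_lt (show i < n from hi)
      · exact le_iSup₂_of_le (f := fun (i : ℕ ⊕ ℕ)
          (_ : i ∈ {x : ℕ ⊕ ℕ | Sum.elim (· ≤ n) (· ≤ n) x}) => urnSigma Δ U i) (Sum.inr n)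
          (le_refl n) le_rfl
    have hI2 : Indep (urnFiltration hΔ hU n) (urnSigma Δ U (Sum.inr n)) P := by
      have h1 := indep_iSup_of_disjoint hle hind
        (S := {x : ℕ ⊕ ℕ | Sum.elim (· ≤ n) (· < n) x}) (T := {Sum.inr n}) (by simp)
      rwa [iSup_singleton] at h1
    have hVm (i : Fin (n + 1)) : StronglyMeasurable[urnSigma Δ U (Sum.inr n)] (V i) :=
      stronglyMeasurable_one.indicator ⟨{i}, measurableSet_singleton i, rfl⟩
    have hψm : StronglyMeasurable[urnSigma Δ U (Sum.inl (n + 1))] ψ := by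
      have hg : Measurable fun x : E => Complex.exp (⟪x, t⟫ * Complex.I) := by fun_prop
      exact (hg.comp (comap_measurable (Δ (n + 1)))).stronglyMeasurable
    have hψi : ∫ ω, ψ ω ∂P = charFun (P.map (Δ 0)) t := by
      rw [← (hΔ_ident (n + 1)).map_eq, charFun_apply,
        integral_map (hΔ (n + 1)).aemeasurable (by fun_prop)]
    have hVi (i : Fin (n + 1)) : ∫ ω, V i ω ∂P = 1 / ((n : ℂ) + 1) := by
      have h1 : P (U n ⁻¹' {i}) = ((n : ENNReal) + 1)⁻¹ := by
        rw [← Measure.map_apply (hU n) (measurableSet_singleton i), hU_unif,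
          PMF.toMeasure_apply_singleton _ _ (measurableSet_singleton i)]
        simp
      simp only [V]
      rw [integral_indicator ((hU n) (measurableSet_singleton i))]
      simp [measureReal_def, h1, ENNReal.toReal_add]
    have hZe (i : Fin (n + 1)) : StronglyMeasurable[urnFiltration hΔ hU n]
        (fun ω => Z ω * e i ω) := hZ.mul (hem i)
    have hZeb (i : Fin (n + 1)) (ω : Ω) : ‖Z ω * e i ω‖ ≤ C := by
      rw [norm_mul, he, Complex.norm_exp_ofReal_mul_I, mul_one]
      exact hZb ω
    have hint (i : Fin (n + 1)) : Integrable (fun ω => Z ω * e i ω) P :=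
      Integrable.of_bound ((hZe i).mono ((urnFiltration hΔ hU).le n)).aestronglyMeasurable C
        (.of_forall (hZeb i))
    have hprod (i : Fin (n + 1)) : ∫ ω, Z ω * e i ω * V i ω * ψ ω ∂P =
        charFun (P.map (Δ 0)) t / ((n : ℂ) + 1) * ∫ ω, Z ω * e i ω ∂P := by
      have hZeV : StronglyMeasurable[urnFiltration hΔ hU n ⊔ urnSigma Δ U (Sum.inr n)]
          fun ω => Z ω * e i ω * V i ω :=
        ((hZe i).mono le_sup_left).mul ((hVm i).mono le_sup_right)
      rw [integral_mul_of_indep (sup_le ((urnFiltration hΔ hU).le n) (hle _)) (hle _) hI1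
        hZeV hψm,
        integral_mul_of_indep ((urnFiltration hΔ hU).le n) (hle _) hI2 (hZe i) (hVm i), hψi, hVi]
      ring
    have hinti (i : Fin (n + 1)) : Integrable (fun ω => Z ω * e i ω * V i ω * ψ ω) P := by
      refine Integrable.of_bound (((((hZe i).mono ((urnFiltration hΔ hU).le n)).mul
        ((hVm i).mono (hle _))).mul (hψm.mono (hle _))).aestronglyMeasurable) C
        (.of_forall fun ω => ?_)
      rw [norm_mul, hψ, Complex.norm_exp_ofReal_mul_I, mul_one, norm_mul]
      have h1 : ‖V i ω‖ ≤ 1 := by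
        refine (norm_indicator_le_norm_self _ _).trans ?_
        simp
      calc _ ≤ ‖Z ω * e i ω‖ * 1 := by gcongr
        _ ≤ C := by rw [mul_one]; exact hZeb i ω
    change ∫ ω, Z ω * e (n + 1) ω ∂P = charFun (P.map (Δ 0)) t / ((n : ℂ) + 1) *
      ∫ ω, Z ω * ∑ i ∈ Finset.range (n + 1), e i ω ∂P
    rw [integral_congr_ae (.of_forall hsplit), integral_finsetSum _ fun i _ => hinti i]
    simp_rw [hprod]
    rw [← Finset.mul_sum, ← integral_finsetSum _ fun i _ => hint i]
    congr 2
    ext ω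
    rw [Finset.sum_range (n := n + 1) (f := fun i => e i ω), Finset.mul_sum]

end Urn

/-! ### Blocks of slowly varying scale and Borel–Cantelli. -/

section Blocks

/-- The index of the block containing `n`: the integer part of `(log (n + 1)) ^ (1 / 4)`. -/
noncomputable def blockIndex (n : ℕ) : ℕ := ⌊(Real.log ((n : ℝ) + 1)) ^ (1 / 4 : ℝ)⌋₊

lemma tendsto_log_natCast_add_one :
    Tendsto (fun n : ℕ => Real.log ((n : ℝ) + 1)) atTop atTop :=
  Real.tendsto_log_atTop.comp
    (tendsto_atTop_add_const_right _ _ tendsto_natCast_atTop_atTop)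

lemma tendsto_blockIndex : Tendsto blockIndex atTop atTop :=
  tendsto_nat_floor_atTop.comp
    ((tendsto_rpow_atTop (by norm_num)).comp tendsto_log_natCast_add_one)

/-- Every `n` in block `k` lies within the time horizon of the `k`-th maximal inequality. -/
lemma le_floor_exp_blockIndex (n : ℕ) :
    n ≤ ⌊Real.exp (((blockIndex n : ℝ) + 1) ^ 4)⌋₊ := by
  refine Nat.le_floor ?_
  have hlog : 0 ≤ Real.log ((n : ℝ) + 1) :=
    Real.log_nonneg (by linarith [(n.cast_nonneg : (0 : ℝ) ≤ n)])
  have h1 := (Nat.lt_floor_add_one ((Real.log ((n : ℝ) + 1)) ^ (1 / 4 : ℝ))).le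
  have h2 : Real.log ((n : ℝ) + 1) ≤ ((blockIndex n : ℝ) + 1) ^ 4 := by
    calc Real.log ((n : ℝ) + 1) = ((Real.log ((n : ℝ) + 1)) ^ (1 / 4 : ℝ)) ^ 4 := by
          rw [← Real.rpow_natCast, ← Real.rpow_mul hlog]; norm_num
      _ ≤ _ := by
          gcongr
          exact h1
  have h3 := (Real.log_le_iff_le_exp (by positivity)).1 h2
  linarith

lemma tendsto_log_div_blockIndex_pow :
    Tendsto (fun n : ℕ => Real.log ((n : ℝ) + 1) / ((blockIndex n ^ 4 : ℕ) : ℝ)) atTop (𝓝 1) := by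
  have h := (tendsto_nat_floor_div_atTop (R := ℝ)).comp
    ((tendsto_rpow_atTop (y := 1 / 4) (by norm_num)).comp tendsto_log_natCast_add_one)
  have h1 := (h.inv₀ one_ne_zero).pow 4
  rw [inv_one, one_pow] at h1
  refine h1.congr fun n => ?_
  have hlog : 0 ≤ Real.log ((n : ℝ) + 1) :=
    Real.log_nonneg (by linarith [(n.cast_nonneg : (0 : ℝ) ≤ n)])
  simp only [Function.comp_apply, inv_div, div_pow]
  rw [← Real.rpow_natCast (Real.log _ ^ (1 / 4 : ℝ)), ← Real.rpow_mul hlog, blockIndex]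
  norm_num

variable {Ω : Type*} {mΩ : MeasurableSpace Ω} {P : Measure Ω} [IsProbabilityMeasure P]
  {𝒢 : Filtration ℕ mΩ}

/-- Almost sure convergence of the averages of urn sequences whose parameter varies slowly with
the number of terms. -/
lemma IsUrnSequence.ae_tendsto_average {φ : ℕ → ℂ} {e : ℕ → ℕ → Ω → ℂ}
    (h : ∀ k, IsUrnSequence P 𝒢 (φ k) (e k)) {C : ℝ} {ℓ : ℂ}
    (hC : ∀ᶠ k : ℕ in atTop, ((k ^ 4 : ℕ) : ℝ) * ‖1 - φ k‖ ≤ C)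
    (hℓ : Tendsto (fun k : ℕ => φ k ^ (k ^ 4)) atTop (𝓝 ℓ)) :
    ∀ᵐ ω ∂P, Tendsto (fun n : ℕ =>
      (∑ i ∈ Finset.range (n + 1), e (blockIndex n) i ω) / ((n : ℂ) + 1)) atTop (𝓝 ℓ) := by
  set C₀ : ℝ := 12 * (∑' j : ℕ, ((j : ℝ) + 1) ^ (-(5 / 4) : ℝ)) + 2 with hC₀
  have hC₀0 : 0 ≤ C₀ := by
    have : 0 ≤ ∑' j : ℕ, ((j : ℝ) + 1) ^ (-(5 / 4) : ℝ) := tsum_nonneg fun j => by positivity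
    positivity
  have hquarter : ∀ᶠ k : ℕ in atTop, ‖1 - φ k‖ ≤ 1 / 4 := by
    have hbig : Tendsto (fun k : ℕ => (k : ℝ)) atTop atTop := tendsto_natCast_atTop_atTop
    filter_upwards [hC, hbig.eventually_ge_atTop (4 * C), eventually_ge_atTop 1] with k h1 h2 h3
    have h4 : (1 : ℝ) ≤ k := by exact_mod_cast h3
    have h5 : (k : ℝ) ≤ (k : ℝ) ^ 4 := le_self_pow₀ h4 (by norm_num)
    push_cast at h1
    have h6 : (k : ℝ) * ‖1 - φ k‖ ≤ k * (1 / 4) := by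
      nlinarith [mul_le_mul_of_nonneg_right h5 (norm_nonneg (1 - φ k))]
    exact le_of_mul_le_mul_left h6 (by linarith)
  obtain ⟨K, hK⟩ := eventually_atTop.1 (hC.and (hquarter.and (eventually_ge_atTop 1)))
  have hCK : 0 ≤ C := (by positivity : (0 : ℝ) ≤ _).trans (hK K le_rfl).1
  -- The threshold `k^(-2)` tends to zero, yet dividing `O(k^(-4))` by it leaves a summable bound.
  let B : ℕ → Set Ω := fun k => {ω | ∃ n ≤ ⌊Real.exp (((k : ℝ) + 1) ^ 4)⌋₊, 1 / (k : ℝ) ^ 2 ≤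
    ‖(∑ i ∈ Finset.range (n + 1), e k i ω) / urnFactor (φ k) n - 1‖ ^ 2}
  have hB (k : ℕ) (hk : K ≤ k) : P (B k) ≤ ENNReal.ofReal (C₀ * C * (1 / (k : ℝ) ^ 2)) := by
    obtain ⟨h1, h2, h3⟩ := hK k hk
    have hk0 : (0 : ℝ) < k := by exact_mod_cast h3
    refine ((h k).measure_exists_le_norm_div_sub_one_sq h2 (by positivity) _).trans
      (ENNReal.ofReal_le_ofReal ?_)
    push_cast at h1
    calc C₀ * ‖1 - φ k‖ / (1 / (k : ℝ) ^ 2)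
        = C₀ * ((k : ℝ) ^ 4 * ‖1 - φ k‖) * (1 / (k : ℝ) ^ 2) := by field_simp
      _ ≤ C₀ * C * (1 / (k : ℝ) ^ 2) := by gcongr
  have hsum : ∑' k, P (B (k + K)) ≠ ⊤ := by
    have hs : Summable fun k : ℕ => C₀ * C * (1 / ((k + K : ℕ) : ℝ) ^ 2) :=
      ((summable_nat_add_iff K).2 (Real.summable_one_div_nat_pow.2 one_lt_two)).mul_left _
    exact ne_top_of_le_ne_top hs.tsum_ofReal_ne_top
      (ENNReal.tsum_le_tsum fun k => hB (k + K) (by lia))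
  have hprod : Tendsto (fun n => ∏ j ∈ Finset.range n,
      (1 - (1 - φ (blockIndex n)) / ((j : ℂ) + 2))) atTop (𝓝 ℓ) := by
    refine tendsto_prod_one_sub_div (m := fun n => blockIndex n ^ 4) (C := C) ?_ ?_
      tendsto_log_div_blockIndex_pow ?_
    · exact (tendsto_pow_atTop (by norm_num)).comp tendsto_blockIndex
    · exact tendsto_blockIndex.eventually hC
    · simp_rw [sub_sub_cancel]
      exact hℓ.comp tendsto_blockIndex
  filter_upwards [ae_eventually_notMem hsum] with ω hω
  have hω' : ∀ᶠ k in atTop, ω ∉ B k := by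
    obtain ⟨a, ha⟩ := eventually_atTop.1 hω
    refine eventually_atTop.2 ⟨a + K, fun k hk => ?_⟩
    have := ha (k - K) (by lia)
    rwa [Nat.sub_add_cancel (by lia)] at this
  have hW : Tendsto (fun n => (∑ i ∈ Finset.range (n + 1), e (blockIndex n) i ω) /
      urnFactor (φ (blockIndex n)) n) atTop (𝓝 1) := by
    rw [tendsto_iff_norm_sub_tendsto_zero]
    have hlim : Tendsto (fun n => 1 / (blockIndex n : ℝ)) atTop (𝓝 0) :=
      tendsto_one_div_atTop_nhds_zero_nat.comp tendsto_blockIndex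
    refine squeeze_zero' (.of_forall fun n => norm_nonneg _) ?_ hlim
    filter_upwards [tendsto_blockIndex.eventually hω'] with n hn
    have hlt : ‖(∑ i ∈ Finset.range (n + 1), e (blockIndex n) i ω) /
        urnFactor (φ (blockIndex n)) n - 1‖ ^ 2 < 1 / (blockIndex n : ℝ) ^ 2 := by
      by_contra! hle
      exact hn ⟨n, le_floor_exp_blockIndex n, hle⟩
    refine le_of_lt (lt_of_pow_lt_pow_left₀ 2 (by positivity) ?_)
    rwa [div_pow, one_pow]
  have hlim := hW.mul hprod
  rw [one_mul] at hlim
  refine hlim.congr' ?_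
  filter_upwards [tendsto_blockIndex.eventually hquarter] with n hn
  have h1 := urnFactor_ne_zero hn n
  have h2 := urnFactor_eq (φ (blockIndex n)) n
  have h3 : (n : ℂ) + 1 ≠ 0 := by exact_mod_cast n.succ_ne_zero
  have h4 : ∏ j ∈ Finset.range n, (1 - (1 - φ (blockIndex n)) / ((j : ℂ) + 2)) =
      urnFactor (φ (blockIndex n)) n / ((n : ℂ) + 1) := by
    rw [h2, mul_div_cancel_left₀ _ h3]
  rw [h4]
  field_simp

end Blocks

/-! ### From characteristic functions to weak convergence of the urn. -/

section Convergence

lemma urnMeasure_toMeasure {E : Type*} [MeasurableSpace E] (x : ℕ → E) (n : ℕ) :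
    (urnMeasure x n : Measure E) = ∑ i ∈ Finset.range n, Measure.dirac (x i) := by
  rw [urnMeasure, FiniteMeasure.toMeasure_sum]
  rfl

variable {E : Type*} [NormedAddCommGroup E] [InnerProductSpace ℝ E] [MeasurableSpace E]
  [BorelSpace E]

open scoped RealInnerProductSpace

/-- The normalized composition of the urn with `n + 1` balls. -/
noncomputable def urnLaw (x : ℕ → E) (n : ℕ) : ProbabilityMeasure E :=
  ⟨((((n + 1 : ℕ) : NNReal)⁻¹ • urnMeasure x (n + 1) : FiniteMeasure E) : Measure E), ⟨by
    rw [FiniteMeasure.toMeasure_smul, urnMeasure_toMeasure, Measure.smul_apply,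
      Measure.finsetSum_apply]
    simp only [measure_univ, Finset.sum_const, Finset.card_range, nsmul_eq_mul, mul_one,
      ENNReal.smul_def, smul_eq_mul]
    rw [ENNReal.coe_inv (by positivity), ENNReal.coe_natCast]
    exact ENNReal.inv_mul_cancel (by simp) (ENNReal.natCast_ne_top _)⟩⟩

lemma charFun_urnLaw (x : ℕ → E) (n : ℕ) (t : E) :
    charFun (urnLaw x n : Measure E) t =
      (∑ i ∈ Finset.range (n + 1), Complex.exp (⟪x i, t⟫ * Complex.I)) / ((n : ℂ) + 1) := by
  change charFun ((((n + 1 : ℕ) : NNReal)⁻¹ • urnMeasure x (n + 1) : FiniteMeasure E) :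
    Measure E) t = _
  rw [charFun_apply, FiniteMeasure.toMeasure_smul, urnMeasure_toMeasure,
    integral_smul_nnreal_measure, integral_finsetSum_measure]
  · simp_rw [integral_dirac]
    rw [NNReal.smul_def, Complex.real_smul, div_eq_inv_mul]
    push_cast
    rfl
  · intro i _
    exact Integrable.of_bound (by fun_prop) 1
      (.of_forall fun x => (Complex.norm_exp_ofReal_mul_I _).le)

/-- The law of `c • Y` for `Y` of law `μ`. -/
noncomputable def scaleLaw (c : ℝ) (μ : ProbabilityMeasure E) : ProbabilityMeasure E :=
  μ.map (f := fun x => c • x) (measurable_const_smul c).aemeasurable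

lemma charFun_scaleLaw (c : ℝ) (μ : ProbabilityMeasure E) (t : E) :
    charFun (scaleLaw c μ : Measure E) t = charFun (μ : Measure E) (c • t) :=
  charFun_map_smul c t

lemma renormalize_urnMeasure_eq (a : ℝ) (x : ℕ → E) (n : ℕ) :
    renormalize a (((n + 1 : ℕ) : NNReal)⁻¹ • urnMeasure x (n + 1)) =
      (scaleLaw a⁻¹ (urnLaw x n)).toFiniteMeasure := rfl

variable [FiniteDimensional ℝ E] {Ω : Type*} {mΩ : MeasurableSpace Ω} {P : Measure Ω}

lemma charFun_map_smul_sum {Δ : ℕ → Ω → E} (hΔ : ∀ i, Measurable (Δ i))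
    (hΔ_indep : iIndepFun Δ P) (hΔ_ident : ∀ i, IdentDistrib (Δ i) (Δ 0) P P) (c : ℝ) (n : ℕ)
    (t : E) : charFun (P.map fun ω => c • ∑ i ∈ Finset.range n, Δ i ω) t =
      charFun (P.map (Δ 0)) (c • t) ^ n := by
  have hs : Measurable fun ω => ∑ i ∈ Finset.range n, Δ i ω :=
    Finset.measurable_sum _ fun i _ => hΔ i
  have h1 : P.map (fun ω => c • ∑ i ∈ Finset.range n, Δ i ω) =
      (P.map fun ω => ∑ i ∈ Finset.range n, Δ i ω).map fun x => c • x := by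
    rw [Measure.map_map (measurable_const_smul c) hs]; rfl
  rw [h1, charFun_map_smul, iIndepFun.charFun_map_fun_finsetSum_eq_prod
    (fun i _ => (hΔ i).aemeasurable) (hΔ_indep.restrict _), Finset.prod_apply]
  simp_rw [(hΔ_ident _).map_eq]
  simp

variable [IsProbabilityMeasure P]

/-- Almost sure weak convergence of the compositions of the urn, normalized with a scale that is
constant on blocks. -/
lemma ae_tendsto_scaleLaw_urnLaw {Δ : ℕ → Ω → E} {U : (n : ℕ) → Ω → Fin (n + 1)}
    (hΔ : ∀ i, Measurable (Δ i)) (hU : ∀ n, Measurable (U n))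
    (hΔ_indep : iIndepFun Δ P) (hΔ_ident : ∀ i, IdentDistrib (Δ i) (Δ 0) P P)
    (hU_indep : iIndepFun U P)
    (hU_unif : ∀ n, P.map (U n) = (PMF.uniformOfFintype (Fin (n + 1))).toMeasure)
    (hΔU : IndepFun (fun ω i => Δ i ω) (fun ω n => U n ω) P) {α : ℝ} (hα : 0 < α)
    {ν : ℕ → ProbabilityMeasure E} {ν₀ : ProbabilityMeasure E} (hν : Tendsto ν atTop (𝓝 ν₀))
    (hνn : ∀ n t, charFun (ν n : Measure E) t =
      charFun (P.map (Δ 0)) (((n : ℝ) ^ α)⁻¹ • t) ^ n) :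
    ∀ᵐ ω ∂P, Tendsto (fun n : ℕ => scaleLaw (((blockIndex n ^ 4 : ℕ) : ℝ) ^ α)⁻¹
      (urnLaw (urnColour (fun i => Δ i ω) (fun k => U k ω)) n)) atTop (𝓝 ν₀) := by
  have hpow : Tendsto (fun k : ℕ => k ^ 4) atTop atTop := tendsto_pow_atTop (by norm_num)
  have hpoint (t : E) : ∀ᵐ ω ∂P, Tendsto (fun n : ℕ =>
      charFun (scaleLaw (((blockIndex n ^ 4 : ℕ) : ℝ) ^ α)⁻¹
        (urnLaw (urnColour (fun i => Δ i ω) (fun k => U k ω)) n) : Measure E) t) atTop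
      (𝓝 (charFun (ν₀ : Measure E) t)) := by
    obtain ⟨C, hC⟩ := exists_eventually_mul_norm_charFun_sub_one_le
      (μ := ⟨P.map (Δ 0), Measure.isProbabilityMeasure_map (hΔ 0).aemeasurable⟩) hα hν hνn t
    have hlim := ProbabilityMeasure.tendsto_iff_tendsto_charFun.1 hν t
    simp_rw [hνn] at hlim
    have := IsUrnSequence.ae_tendsto_average (ℓ := charFun (ν₀ : Measure E) t) (C := C)
      (fun k : ℕ => isUrnSequence_exp_urnColour hΔ hU hΔ_indep hΔ_ident hU_indep hU_unif hΔU
        ((((k ^ 4 : ℕ) : ℝ) ^ α)⁻¹ • t)) (by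
          filter_upwards [hpow.eventually hC] with k hk
          rw [norm_sub_rev]
          exact hk) (hlim.comp hpow)
    simp_rw [charFun_scaleLaw, charFun_urnLaw]
    exact this
  -- Joint measurability permits exchanging "for each `t`, almost surely" with "almost surely, for
  -- almost every `t`".
  have hmeas : MeasurableSet {p : Ω × E | Tendsto (fun n : ℕ =>
      charFun (scaleLaw (((blockIndex n ^ 4 : ℕ) : ℝ) ^ α)⁻¹
        (urnLaw (urnColour (fun i => Δ i p.1) (fun k => U k p.1)) n) : Measure E) p.2) atTop
      (𝓝 (charFun (ν₀ : Measure E) p.2))} := by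
    refine measurableSet_tendsto_fun (fun n => ?_) (measurable_charFun.comp measurable_snd)
    simp_rw [charFun_scaleLaw, charFun_urnLaw]
    have hX (i : ℕ) : Measurable fun p : Ω × E =>
        urnColour (fun i => Δ i p.1) (fun k => U k p.1) i :=
      (measurable_urnColour (N := i) (fun i _ => hΔ i) (fun i _ => hU i) le_rfl).comp measurable_fst
    fun_prop
  have hae := (Measure.ae_ae_comm (μ := P) (ν := (volume : Measure E)) hmeas).2
    (.of_forall hpoint)
  filter_upwards [hae] with ω hω
  exact ProbabilityMeasure.tendsto_iff_tendsto_charFun.2 (tendsto_charFun_of_ae hω)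

/-- A scale that is constant on blocks can be replaced by the logarithmic one. -/
lemma tendsto_scaleLaw_log {α : ℝ} {μ : ℕ → ProbabilityMeasure E} {ν₀ : ProbabilityMeasure E}
    (h : Tendsto (fun n : ℕ => scaleLaw (((blockIndex n ^ 4 : ℕ) : ℝ) ^ α)⁻¹ (μ n)) atTop (𝓝 ν₀)) :
    Tendsto (fun n : ℕ => scaleLaw (Real.log ((n : ℝ) + 1) ^ α)⁻¹ (μ n)) atTop (𝓝 ν₀) := by
  refine ProbabilityMeasure.tendsto_iff_tendsto_charFun.2 fun t => ?_
  have hc : Tendsto (fun n : ℕ =>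
      ((Real.log ((n : ℝ) + 1) / ((blockIndex n ^ 4 : ℕ) : ℝ)) ^ α)⁻¹) atTop (𝓝 1) := by
    have := (tendsto_log_div_blockIndex_pow.rpow_const (p := α) (.inl one_ne_zero)).inv₀
      (by simp)
    simpa using this
  refine (tendsto_charFun_smul h hc t).congr' ?_
  filter_upwards [tendsto_blockIndex.eventually_ge_atTop 1,
    tendsto_log_natCast_add_one.eventually_gt_atTop 0] with n h1 h2
  rw [charFun_scaleLaw, charFun_scaleLaw, smul_smul]
  congr 2
  have h3 : (0 : ℝ) < ((blockIndex n ^ 4 : ℕ) : ℝ) := by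
    exact_mod_cast pow_pos (by lia : 0 < blockIndex n) 4
  rw [Real.div_rpow h2.le h3.le]
  have h4 : (((blockIndex n ^ 4 : ℕ) : ℝ)) ^ α ≠ 0 := by positivity
  have h5 : Real.log ((n : ℝ) + 1) ^ α ≠ 0 := by positivity
  field_simp

end Convergence

theorem theorem1 {Ω Ω' : Type*} [MeasurableSpace Ω] [MeasurableSpace Ω']
    (P : Measure Ω) [IsProbabilityMeasure P] (P' : Measure Ω') [IsProbabilityMeasure P']
    (d : ℕ)
    -- the i.i.d. displacements
    (Δ : ℕ → Ω → EuclideanSpace ℝ (Fin d))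
    (hΔ_meas : ∀ i, Measurable (Δ i))
    (hΔ_indep : iIndepFun Δ P)
    (hΔ_ident : ∀ i, IdentDistrib (Δ i) (Δ 0) P P)
    -- the independent choices, `U n` uniform in `{0, …, n}`
    (U : (n : ℕ) → Ω → Fin (n + 1))
    (hU_meas : ∀ n, Measurable (U n))
    (hU_indep : iIndepFun U P)
    (hU_unif : ∀ n, P.map (U n) = (PMF.uniformOfFintype (Fin (n + 1))).toMeasure)
    -- the choices are independent of the displacements
    (hΔU : IndepFun (fun ω i => Δ i ω) (fun ω n => U n ω) P)
    -- the displacements are in the stable regime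
    (α : ℝ) (hα : 0 < α)
    (Λ : Ω' → EuclideanSpace ℝ (Fin d)) (hΛ : Measurable Λ)
    (hstable : TendstoInDistribution
      (fun (n : ℕ) ω => (1 / (n : ℝ) ^ α) • ∑ i ∈ Finset.range n, Δ i ω)
      atTop Λ (fun _ => P) P') :
    ∀ᵐ ω ∂P,
      Tendsto
        (fun n : ℕ => renormalize ((Real.log (n : ℝ)) ^ α)
          ((n : NNReal)⁻¹ • urnMeasure (urnColour (fun i => Δ i ω) (fun k => U k ω)) n))
        atTop
        (𝓝 (ProbabilityMeasure.toFiniteMeasure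
          ⟨P'.map Λ, Measure.isProbabilityMeasure_map hΛ.aemeasurable⟩)) := by
  have hn (n : ℕ) (t : EuclideanSpace ℝ (Fin d)) :
      charFun (P.map fun ω => (1 / (n : ℝ) ^ α) • ∑ i ∈ Finset.range n, Δ i ω) t =
        charFun (P.map (Δ 0)) (((n : ℝ) ^ α)⁻¹ • t) ^ n := by
    rw [charFun_map_smul_sum hΔ_meas hΔ_indep hΔ_ident, one_div]
  filter_upwards [ae_tendsto_scaleLaw_urnLaw hΔ_meas hU_meas hΔ_indep hΔ_ident hU_indep hU_unif
    hΔU hα hstable.tendsto hn] with ω hω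
  -- `urnLaw` at index `n` has `n + 1` balls, which avoids the empty urn and matches the scale `log
  -- (n + 1)`.
  rw [← tendsto_add_atTop_iff_nat 1]
  have h := (ProbabilityMeasure.tendsto_nhds_iff_toFiniteMeasure_tendsto_nhds _).1
    (tendsto_scaleLaw_log hω)
  refine h.congr fun n => ?_
  rw [Function.comp_apply, ← renormalize_urnMeasure_eq, Nat.cast_add_one (R := ℝ)]
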